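/- All manifolds are smooth and oriented, and connected unless stated otherwise. Let $R$ be a closed oriented surface (possibly disconnected or empty). A compact 3-manifold with boundary parametrized by $R$ is a compact connected oriented 3-manifold $M$ together with an orientation-preserving diffeomorphism $m\colon R\to\partial M$. Let $\mathcal V(R)$ be the set of these manifolds up to orientation-preserving diffeomorphisms compatible with the boundary parametrizations. For a compact connected oriented surface $S$ with $\partial S\cong S^1$, the Torelli group $\mathcal I(S)$ is the group of isotopy classes rel boundary of orientation-preserving diffeomorphisms of $S$ fixing (a neighbourhood of) $\partial S$ pointwise and acting trivially on $H_1(S;\mathbb Z)$. Its lower central series is $\Gamma_1\mathcal I(S)=\mathcal I(S)$, $\Gamma_{k+1}\mathcal I(S)=[\Gamma_k\mathcal I(S),\mathcal I(S)]$. If $S$ is embedded in the interior of $M$ and $s\in\mathcal I(S)$, the twist of $M$ along $S$ with $s$ is the manifold $M_s$ obtained by cutting $M$ open along $S$ and gluing back with $s$, with the induced boundary parametrization; one twists simultaneously along a disjoint union $\sqcup_j S_j$ with $\sqcup_j s_j$ in the same way. For $k\ge 1$, two elements $M,M'$ of $\mathcal V(R)$ are $Y_k$-equivalent if $M'\cong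 M_s$ for some such $S\subset\operatorname{int}(M)$ and some $s\in\Gamma_k\mathcal I(S)$. Let $\mathcal V_0\subset\mathcal V(R)$ be a $Y_1$-equivalence class, let $A$ be an abelian group and let $d\ge 0$ be an integer. A map $F\colon\mathcal V_0\to A$ is a finite-type invariant of degree at most $d$ if, for every $M\in\mathcal V_0$, all pairwise disjoint compact connected oriented surfaces $S_0,\dots,S_d\subset\operatorname{int}(M)$ with $\partial S_i\cong S^1$, and all $s_i\in\mathcal I(S_i)$, $$\sum_{J\subset\{0,\dots,d\}}(-1)^{|J|}F(M_J)=0,$$ where $M_J\in\mathcal V_0$ is obtained from $M$ by the twist along $\sqcup_{j\in J}S_j$ with $\sqcup_{j\in J}s_j$. **Proposition.** Let $M,M'\in\mathcal V_0$. If $M$ and $M'$ are $Y_{d+1}$-equivalent, then $F(M)=F(M')$ for every finite-type invariant $F\colon\mathcal V_0\to A$ of degree at most $d$. -/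

import Mathlib

open scoped Manifold ContDiff Topology
open Set

universe u v

noncomputable section

/-! ### Orientations of smooth manifolds -/

/-- The family of vectors `v` is a basis that is positively oriented with respect to `o`. -/
def IsPositiveFrame {V : Type*} [AddCommGroup V] [Module ℝ V] {n : ℕ}
    (o : Orientation ℝ V (Fin n)) (v : Fin n → V) : Prop :=
  ∃ b : Module.Basis (Fin n) ℝ V, ⇑b = v ∧ b.orientation = o

/-- An orientation of a smooth `n`-manifold: an orientation of every tangent space, such that the
differential of the chart at `x₀` carries the orientations at all points `x` near `x₀` to one and
the same orientation of the model vector space. -/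
structure ManifoldOrientation {n : ℕ} {H : Type*} [TopologicalSpace H]
    (I : ModelWithCorners ℝ (EuclideanSpace ℝ (Fin n)) H)
    (M : Type*) [TopologicalSpace M] [ChartedSpace H M] where
  /-- the orientation of the tangent space at `x` -/
  atPoint : ∀ x : M, Orientation ℝ (TangentSpace I x) (Fin n)
  locally_constant : ∀ x₀ : M, ∃ o : Orientation ℝ (EuclideanSpace ℝ (Fin n)) (Fin n),
    ∀ᶠ x in 𝓝 x₀, ∀ v : Fin n → TangentSpace I x, IsPositiveFrame (atPoint x) v →
      IsPositiveFrame o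
        (fun i => (mfderiv I 𝓘(ℝ, EuclideanSpace ℝ (Fin n)) (extChartAt I x₀) x (v i) :
          EuclideanSpace ℝ (Fin n)))

/-- The differential of `f` at `x` carries the orientation at `x` to the one at `f x`. -/
def OrientationPreservingAt {n : ℕ} {H H' : Type*} [TopologicalSpace H] [TopologicalSpace H']
    {I : ModelWithCorners ℝ (EuclideanSpace ℝ (Fin n)) H}
    {I' : ModelWithCorners ℝ (EuclideanSpace ℝ (Fin n)) H'}
    {M M' : Type*} [TopologicalSpace M] [ChartedSpace H M]
    [TopologicalSpace M'] [ChartedSpace H' M']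
    (o : ManifoldOrientation I M) (o' : ManifoldOrientation I' M') (f : M → M') (x : M) : Prop :=
  ∀ v : Fin n → TangentSpace I x, IsPositiveFrame (o.atPoint x) v →
    IsPositiveFrame (o'.atPoint (f x)) (fun i => mfderiv I I' f x (v i))

theorem isPositiveFrame_symm {V W : Type*} [AddCommGroup V] [Module ℝ V]
    [AddCommGroup W] [Module ℝ W] {n : ℕ} [NeZero n]
    {o : Orientation ℝ V (Fin n)} {o' : Orientation ℝ W (Fin n)} (L : V ≃ₗ[ℝ] W)
    (hL : ∀ v, IsPositiveFrame o v → IsPositiveFrame o' (fun i => L (v i)))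
    {w : Fin n → W} (hw : IsPositiveFrame o' w) : IsPositiveFrame o (fun i => L.symm (w i)) := by
  obtain ⟨b, rfl, hb⟩ := hw
  let c := (b.map L.symm).adjustToOrientation o
  have hc : c.orientation = o := Module.Basis.orientation_adjustToOrientation _ _
  obtain ⟨c', hc', hc'o⟩ := hL c ⟨c, rfl, hc⟩
  have e : c' = c.map L := by
    ext i
    rw [hc']
    simp
  rw [e, Module.Basis.orientation_map, hc] at hc'o
  refine ⟨b.map L.symm, by ext i; simp, ?_⟩
  rw [Module.Basis.orientation_map, hb, ← hc'o, ← Orientation.map_symm]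
  exact (Orientation.map (Fin n) L).symm_apply_apply o

theorem OrientationPreservingAt.comp {n : ℕ} {H H' H'' : Type*} [TopologicalSpace H]
    [TopologicalSpace H'] [TopologicalSpace H'']
    {I : ModelWithCorners ℝ (EuclideanSpace ℝ (Fin n)) H}
    {I' : ModelWithCorners ℝ (EuclideanSpace ℝ (Fin n)) H'}
    {I'' : ModelWithCorners ℝ (EuclideanSpace ℝ (Fin n)) H''}
    {M M' M'' : Type*} [TopologicalSpace M] [ChartedSpace H M]
    [TopologicalSpace M'] [ChartedSpace H' M'] [TopologicalSpace M''] [ChartedSpace H'' M'']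
    {o : ManifoldOrientation I M} {o' : ManifoldOrientation I' M'}
    {o'' : ManifoldOrientation I'' M''} {g : M' → M''} {f : M → M'} {x : M}
    (hg : ContMDiff I' I'' ∞ g) (hf : ContMDiff I I' ∞ f)
    (hg' : OrientationPreservingAt o' o'' g (f x)) (hf' : OrientationPreservingAt o o' f x) :
    OrientationPreservingAt o o'' (fun y => g (f y)) x := by
  intro v hv
  have h := hg' _ (hf' v hv)
  have e : mfderiv I I'' (fun y => g (f y)) x
      = (mfderiv I' I'' g (f x)).comp (mfderiv I I' f x) :=
    mfderiv_comp x (hg.mdifferentiableAt (by simp)) (hf.mdifferentiableAt (by simp))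
  rw [e]
  exact h

theorem orientationPreservingAt_id {n : ℕ} {H : Type*} [TopologicalSpace H]
    {I : ModelWithCorners ℝ (EuclideanSpace ℝ (Fin n)) H}
    {M : Type*} [TopologicalSpace M] [ChartedSpace H M]
    (o : ManifoldOrientation I M) (x : M) : OrientationPreservingAt o o (fun y => y) x := by
  intro v hv
  have e : mfderiv I I (fun y : M => y) x = ContinuousLinearMap.id ℝ _ := mfderiv_id
  rw [e]
  exact hv

theorem orientationPreservingAt_symm {n : ℕ} [NeZero n] {H H' : Type*} [TopologicalSpace H]
    [TopologicalSpace H']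
    {I : ModelWithCorners ℝ (EuclideanSpace ℝ (Fin n)) H}
    {I' : ModelWithCorners ℝ (EuclideanSpace ℝ (Fin n)) H'}
    {M M' : Type*} [TopologicalSpace M] [ChartedSpace H M]
    [TopologicalSpace M'] [ChartedSpace H' M']
    {o : ManifoldOrientation I M} {o' : ManifoldOrientation I' M'}
    (f : M ≃ₘ^∞⟮I, I'⟯ M') (hf : ∀ x, OrientationPreservingAt o o' f x) (y : M') :
    OrientationPreservingAt o' o f.symm y := by
  obtain ⟨x, rfl⟩ := f.surjective y
  intro w hw
  let L : TangentSpace I x ≃ₗ[ℝ] TangentSpace I' (f x) :=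
    (f.mfderivToContinuousLinearEquiv (by simp) x).toLinearEquiv
  have key := isPositiveFrame_symm L (o := o.atPoint x) (o' := o'.atPoint (f x)) (hf x) hw
  have e : ∀ u, mfderiv I' I f.symm (f x) u = L.symm u := by
    intro u
    have h1 : mfderiv I I (fun y => f.symm (f y)) x
        = (mfderiv I' I f.symm (f x)).comp (mfderiv I I' f x) :=
      mfderiv_comp x (f.symm.contMDiff.mdifferentiableAt (by simp))
        (f.contMDiff.mdifferentiableAt (by simp))
    have h2 : (fun y => f.symm (f y)) = (fun y : M => y) := by ext; simp
    have h3 : mfderiv I I (fun y => f.symm (f y)) x = ContinuousLinearMap.id ℝ _ := by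
      rw [h2]; exact mfderiv_id
    have h4 : mfderiv I' I f.symm (f x) (L (L.symm u)) = L.symm u :=
      congrArg (fun T : TangentSpace I x →L[ℝ] TangentSpace I x => T (L.symm u))
        (h1.symm.trans h3)
    rw [LinearEquiv.apply_symm_apply] at h4
    exact h4
  have hx : ∀ x' : M, x' = x → IsPositiveFrame (V := TangentSpace I x') (o.atPoint x')
      (fun i => (L.symm (w i) : EuclideanSpace ℝ (Fin n))) := by
    rintro _ rfl
    exact key
  have hw' : (fun i => (mfderiv I' I f.symm (f x) (w i) : EuclideanSpace ℝ (Fin n)))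
      = fun i => (L.symm (w i) : EuclideanSpace ℝ (Fin n)) := funext fun i => e (w i)
  exact hw' ▸ hx _ (f.symm_apply_apply x)

/-! ### Compact surfaces with one boundary component and their Torelli groups -/

/-- A compact connected oriented smooth surface whose boundary is a circle. -/
structure BoundedSurface where
  carrier : Type u
  [topology : TopologicalSpace carrier]
  [charted : ChartedSpace (EuclideanHalfSpace 2) carrier]
  [smooth : IsManifold (𝓡∂ 2) ∞ carrier]
  [hausdorff : T2Space carrier]
  [compact : CompactSpace carrier]
  [connected : ConnectedSpace carrier]
  orientation : ManifoldOrientation (𝓡∂ 2) carrier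
  boundary_circle : Nonempty ((𝓡∂ 2).boundary carrier ≃ₜ Circle)

attribute [instance] BoundedSurface.topology BoundedSurface.charted BoundedSurface.smooth
  BoundedSurface.hausdorff BoundedSurface.compact BoundedSurface.connected

namespace BoundedSurface

instance : CoeSort BoundedSurface.{u} (Type u) := ⟨carrier⟩

/-- The group (under composition) of orientation-preserving self-diffeomorphisms of `S` that are
the identity near `∂S`. Requiring this near `∂S`, for diffeomorphisms and for isotopies alike, does
not change the group of isotopy classes relative to `∂S`, and makes the regluing smooth. -/
def diffeoGroup (S : BoundedSurface.{u}) : Subgroup (Equiv.Perm S) where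
  carrier := {f | ContMDiff (𝓡∂ 2) (𝓡∂ 2) ∞ f ∧ ContMDiff (𝓡∂ 2) (𝓡∂ 2) ∞ f.symm ∧
    (∀ x, OrientationPreservingAt S.orientation S.orientation f x) ∧
    ∀ᶠ x in 𝓝ˢ ((𝓡∂ 2).boundary S), f x = x}
  mul_mem' := by
    rintro f g ⟨hf, hf', hfo, hfb⟩ ⟨hg, hg', hgo, hgb⟩
    refine ⟨hf.comp hg, hg'.comp hf', fun x => OrientationPreservingAt.comp (g := f) (f := g) hf hg (hfo (g x)) (hgo x), ?_⟩
    filter_upwards [hfb, hgb] with x h1 h2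
    rw [Equiv.Perm.mul_apply, h2, h1]
  one_mem' := ⟨contMDiff_id, contMDiff_id, fun x => orientationPreservingAt_id _ x,
    Filter.Eventually.of_forall fun _ => rfl⟩
  inv_mem' := by
    rintro f ⟨hf, hf', hfo, hfb⟩
    refine ⟨hf', hf, fun x => ?_, ?_⟩
    · exact orientationPreservingAt_symm (f := (⟨f, hf, hf'⟩ : S ≃ₘ^∞⟮𝓡∂ 2, 𝓡∂ 2⟯ S)) hfo x
    · filter_upwards [hfb] with x h
      exact (Equiv.Perm.eq_inv_iff_eq.mpr h).symm

/-- The diffeomorphisms `f` that are isotopic to the identity relative to a neighbourhood of `∂S`: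
there is a smooth family `φ t` of diffeomorphisms (with smooth family of inverses) with `φ 0 = 1`
and `φ 1 = f`, fixing every point of a neighbourhood of `∂S`. -/
def isotopicToOne (S : BoundedSurface.{u}) : Subgroup S.diffeoGroup where
  carrier := {f | ∃ φ : ℝ → S.diffeoGroup, φ 0 = 1 ∧ φ 1 = f ∧
    ContMDiff (𝓘(ℝ, ℝ).prod (𝓡∂ 2)) (𝓡∂ 2) ∞ (fun p : ℝ × S => (φ p.1).1 p.2) ∧
    ContMDiff (𝓘(ℝ, ℝ).prod (𝓡∂ 2)) (𝓡∂ 2) ∞ (fun p : ℝ × S => (φ p.1).1.symm p.2) ∧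
    ∀ᶠ x in 𝓝ˢ ((𝓡∂ 2).boundary S), ∀ t, (φ t).1 x = x}
  mul_mem' := by
    rintro f g ⟨φ, hφ0, hφ1, hφ, hφ', hφb⟩ ⟨ψ, hψ0, hψ1, hψ, hψ', hψb⟩
    refine ⟨fun t => φ t * ψ t, by simp [hφ0, hψ0], by simp [hφ1, hψ1],
      hφ.comp (contMDiff_fst.prodMk hψ), hψ'.comp (contMDiff_fst.prodMk hφ'), ?_⟩
    filter_upwards [hφb, hψb] with x h1 h2 t
    change (φ t).1 ((ψ t).1 x) = x
    rw [h2, h1]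
  one_mem' := ⟨fun _ => 1, rfl, rfl, contMDiff_snd, contMDiff_snd,
    Filter.Eventually.of_forall fun _ _ => rfl⟩
  inv_mem' := by
    rintro f ⟨φ, hφ0, hφ1, hφ, hφ', hφb⟩
    refine ⟨fun t => (φ t)⁻¹, by simp [hφ0], by simp [hφ1], hφ', hφ, ?_⟩
    filter_upwards [hφb] with x h t
    exact (Equiv.Perm.eq_inv_iff_eq.mpr (h t)).symm

instance (S : BoundedSurface.{u}) : S.isotopicToOne.Normal where
  conj_mem := by
    rintro f ⟨φ, hφ0, hφ1, hφ, hφ', hφb⟩ g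
    have hg : ContMDiff (𝓡∂ 2) (𝓡∂ 2) ∞ g.1 := g.2.1
    have hg' : ContMDiff (𝓡∂ 2) (𝓡∂ 2) ∞ g.1.symm := g.2.2.1
    refine ⟨fun t => g * φ t * g⁻¹, by simp [hφ0], by simp [hφ1],
      hg.comp (hφ.comp (contMDiff_fst.prodMk (hg'.comp contMDiff_snd))),
      hg.comp (hφ'.comp (contMDiff_fst.prodMk (hg'.comp contMDiff_snd))), ?_⟩
    filter_upwards [hφb, g.2.2.2.2] with x h1 h2 t
    have h3 : g.1.symm x = x := (Equiv.Perm.eq_inv_iff_eq.mpr h2).symm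
    change g.1 ((φ t).1 (g.1.symm x)) = x
    rw [h3, h1, h2]

/-- The mapping class group of `S` relative to its boundary. -/
abbrev MappingClassGroup (S : BoundedSurface.{u}) : Type u := S.diffeoGroup ⧸ S.isotopicToOne

/-- An element of `S.diffeoGroup` as a morphism of topological spaces. -/
def toTopHom {S : BoundedSurface.{u}} (f : S.diffeoGroup) : TopCat.of S ⟶ TopCat.of S :=
  TopCat.ofHom ⟨f.1, f.2.1.continuous⟩

/-- The singular homology functor `H₁(-; ℤ)`. -/
def integralH1 : CategoryTheory.Functor TopCat.{u} (ModuleCat.{u} ℤ) :=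
  (AlgebraicTopology.singularHomologyFunctor (ModuleCat.{u} ℤ) 1).obj
    (ModuleCat.of ℤ (ULift.{u} ℤ))

/-- The diffeomorphisms that act trivially on `H₁(S; ℤ)`. -/
def torelliDiffeo (S : BoundedSurface.{u}) : Subgroup S.diffeoGroup where
  carrier := {f | integralH1.map (toTopHom f) = CategoryTheory.CategoryStruct.id _}
  mul_mem' := by
    intro f g hf hg
    have h : toTopHom (f * g) = CategoryTheory.CategoryStruct.comp (toTopHom g) (toTopHom f) := rfl
    rw [mem_ofPred_eq] at hf hg ⊢
    rw [h, CategoryTheory.Functor.map_comp, hf, hg, CategoryTheory.Category.comp_id]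
  one_mem' := integralH1.map_id (TopCat.of S)
  inv_mem' := by
    intro f hf
    have h : CategoryTheory.CategoryStruct.comp (toTopHom f) (toTopHom f⁻¹)
        = CategoryTheory.CategoryStruct.id (TopCat.of S) := by
      ext x
      exact f.1.symm_apply_apply x
    rw [mem_ofPred_eq] at hf ⊢
    rw [← CategoryTheory.Category.id_comp (integralH1.map (toTopHom f⁻¹)), ← hf,
      ← CategoryTheory.Functor.map_comp, h, CategoryTheory.Functor.map_id, hf]

/-- The Torelli group: the subgroup of mapping classes acting trivially on `H₁(S; ℤ)`. -/
def torelli (S : BoundedSurface.{u}) : Subgroup S.MappingClassGroup :=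
  S.torelliDiffeo.map (QuotientGroup.mk' S.isotopicToOne)

/-- The `k`-th term of the lower central series of the Torelli group, indexed from `k = 1`:
the first term is the Torelli group itself, and each next one is `[Γ_k, Γ_1]`. -/
def torelliLCS (S : BoundedSurface.{u}) (k : ℕ) : Subgroup S.MappingClassGroup :=
  S.torelli.lowerCentralSeries (k - 1)

end BoundedSurface

/-! ### Compact 3-manifolds with parametrized boundary -/

/-- A compact connected oriented smooth 3-manifold `M` with boundary parametrized by the closed
oriented surface `R` (possibly disconnected or empty): an orientation-preserving diffeomorphism
`param` from `R` onto `∂M`. The orientation of `∂M` follows the convention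
"outward vector first"; in the chart at a boundary point, `M` is the half-space of points with
nonnegative coordinate `0`, so that outward vectors are those with negative coordinate `0`. -/
structure ParamManifold {R : Type v} [TopologicalSpace R]
    [ChartedSpace (EuclideanSpace ℝ (Fin 2)) R] (oR : ManifoldOrientation (𝓡 2) R) where
  carrier : Type u
  [topology : TopologicalSpace carrier]
  [charted : ChartedSpace (EuclideanHalfSpace 3) carrier]
  [smooth : IsManifold (𝓡∂ 3) ∞ carrier]
  [hausdorff : T2Space carrier]
  [compact : CompactSpace carrier]
  [connected : ConnectedSpace carrier]
  orientation : ManifoldOrientation (𝓡∂ 3) carrier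
  param : R → carrier
  param_smooth : ContMDiff (𝓡 2) (𝓡∂ 3) ∞ param
  param_injective : Function.Injective param
  param_range : range param = (𝓡∂ 3).boundary carrier
  param_orientation : ∀ (r : R) (v : Fin 2 → TangentSpace (𝓡 2) r),
    IsPositiveFrame (oR.atPoint r) v →
    ∀ n : EuclideanSpace ℝ (Fin 3), n 0 < 0 →
      IsPositiveFrame (orientation.atPoint (param r))
        ![n, mfderiv (𝓡 2) (𝓡∂ 3) param r (v 0), mfderiv (𝓡 2) (𝓡∂ 3) param r (v 1)]

attribute [instance] ParamManifold.topology ParamManifold.charted ParamManifold.smooth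
  ParamManifold.hausdorff ParamManifold.compact ParamManifold.connected

namespace ParamManifold

variable {R : Type v} [TopologicalSpace R] [ChartedSpace (EuclideanSpace ℝ (Fin 2)) R]
  {oR : ManifoldOrientation (𝓡 2) R}

instance : CoeSort (ParamManifold.{u} oR) (Type u) := ⟨carrier⟩

/-- Diffeomorphism of 3-manifolds with parametrized boundary: orientation-preserving and
compatible with the boundary parametrizations. -/
instance setoid (oR : ManifoldOrientation (𝓡 2) R) : Setoid (ParamManifold.{u} oR) where
  r M M' := ∃ f : M ≃ₘ^∞⟮𝓡∂ 3, 𝓡∂ 3⟯ M',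
    (∀ x, OrientationPreservingAt M.orientation M'.orientation f x) ∧
    ∀ r, f (M.param r) = M'.param r
  iseqv := by
    refine ⟨fun M => ⟨Diffeomorph.refl _ _ _, fun x => orientationPreservingAt_id _ x,
      fun _ => rfl⟩, ?_, ?_⟩
    · rintro M M' ⟨f, hf, hfp⟩
      exact ⟨f.symm, fun y => orientationPreservingAt_symm f hf y,
        fun r => by rw [← hfp r, f.symm_apply_apply]⟩
    · rintro M M' M'' ⟨f, hf, hfp⟩ ⟨g, hg, hgp⟩
      refine ⟨f.trans g, fun x => OrientationPreservingAt.comp (g := g) (f := f)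
        g.contMDiff f.contMDiff (hg (f x)) (hf x), fun r => ?_⟩
      change g (f (M.param r)) = M''.param r
      rw [hfp, hgp]

end ParamManifold

/-- The set of diffeomorphism classes of compact 3-manifolds with boundary parametrized
by `R`. -/
abbrev ParamClass {R : Type v} [TopologicalSpace R] [ChartedSpace (EuclideanSpace ℝ (Fin 2)) R]
    (oR : ManifoldOrientation (𝓡 2) R) : Type (max (u + 1) v) :=
  Quotient (ParamManifold.setoid.{u} oR)

section Twists

variable {R : Type v} [TopologicalSpace R] [ChartedSpace (EuclideanSpace ℝ (Fin 2)) R]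
  {oR : ManifoldOrientation (𝓡 2) R}

/-- A compact surface `S` with one boundary component in the interior of `M`, together with a
two-sided product neighbourhood: an orientation-preserving smooth embedding of `S × ℝ` in the
interior of `M`, the surface being the image of `S × {0}`. (Preserving the orientation includes
that the differential is injective; over the interior of `S` the embedding is open.) -/
structure EmbeddedSurface (M : ParamManifold.{u} oR) where
  S : BoundedSurface.{u}
  thick : S × ℝ → M
  thick_smooth : ContMDiff ((𝓡∂ 2).prod 𝓘(ℝ, ℝ)) (𝓡∂ 3) ∞ thick
  thick_embedding : Topology.IsEmbedding thick
  thick_interior : range thick ⊆ (𝓡∂ 3).interior M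
  thick_open : ∀ x ∈ (𝓡∂ 2).interior S, ∀ t : ℝ,
    IsLocalDiffeomorphAt ((𝓡∂ 2).prod 𝓘(ℝ, ℝ)) (𝓡∂ 3) ∞ thick (x, t)
  thick_orientation : ∀ (x : S) (t : ℝ) (v : Fin 2 → TangentSpace (𝓡∂ 2) x),
    IsPositiveFrame (S.orientation.atPoint x) v →
      IsPositiveFrame (M.orientation.atPoint (thick (x, t)))
        ![mfderiv ((𝓡∂ 2).prod 𝓘(ℝ, ℝ)) (𝓡∂ 3) thick (x, t) (v 0, (0 : ℝ)),
          mfderiv ((𝓡∂ 2).prod 𝓘(ℝ, ℝ)) (𝓡∂ 3) thick (x, t) (v 1, (0 : ℝ)),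
          mfderiv ((𝓡∂ 2).prod 𝓘(ℝ, ℝ)) (𝓡∂ 3) thick (x, t)
            ((0 : EuclideanSpace ℝ (Fin 2)), (1 : ℝ))]

/-- The surface itself, as a subset of `M`. -/
def EmbeddedSurface.image {M : ParamManifold.{u} oR} (E : EmbeddedSurface M) : Set M :=
  range fun x : E.S => E.thick (x, 0)

/-- `N` is obtained from `M` by a twist along the disjoint union of the surfaces `E i` with the
mapping classes `s i`: one cuts `M` open along the surfaces and glues back, the point `(x, 0)` on
the lower side of `E i` being glued to the point `(f i x, 0)` on its upper side, where `f i` is a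
diffeomorphism in the class `s i`.

This is expressed by a bijection `h` from `M` to `N`, compatible with the boundary
parametrizations, that is an orientation-preserving local diffeomorphism away from the supports
of the `f i` in the surfaces, and becomes a local diffeomorphism across the interiors of the
surfaces when it is precomposed with `f i` on the upper side `t > 0` of the `i`-th surface. -/
def IsTwist {ι : Type} (M : ParamManifold.{u} oR) (E : ι → EmbeddedSurface M)
    (s : ∀ i, (E i).S.MappingClassGroup) (N : ParamManifold.{u} oR) : Prop :=
  ∃ (f : ∀ i, (E i).S.diffeoGroup) (h : M ≃ N),
    (∀ i, QuotientGroup.mk (f i) = s i) ∧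
    (∀ r, h (M.param r) = N.param r) ∧
    (∀ p : M, (∀ i, ∀ x ∈ closure {x | (f i).1 x ≠ x}, p ≠ (E i).thick (x, 0)) →
      IsLocalDiffeomorphAt (𝓡∂ 3) (𝓡∂ 3) ∞ h p ∧
      OrientationPreservingAt M.orientation N.orientation h p) ∧
    ∀ i, ∀ x ∈ (𝓡∂ 2).interior (E i).S,
      IsLocalDiffeomorphAt ((𝓡∂ 2).prod 𝓘(ℝ, ℝ)) (𝓡∂ 3) ∞
        (fun q : (E i).S × ℝ =>
          if q.2 ≤ 0 then h ((E i).thick q) else h ((E i).thick ((f i).1 q.1, q.2))) (x, 0)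

/-- `Y_k`-equivalence, for `k ≥ 1`: the second manifold is obtained from the first by a Torelli
twist along one surface with an element of the `k`-th term of the lower central series of the
Torelli group. -/
def YEquiv (k : ℕ) (a b : ParamClass.{u} oR) : Prop :=
  ∃ M N : ParamManifold.{u} oR, ⟦M⟧ = a ∧ ⟦N⟧ = b ∧
    ∃ (E : EmbeddedSurface M) (s : E.S.MappingClassGroup), s ∈ E.S.torelliLCS k ∧
      IsTwist M (fun _ : Unit => E) (fun _ => s) N

/-- The `Y_1`-equivalence class `V₀`, as a set of diffeomorphism classes. -/
abbrev YOneClass (V₀ : Quot (YEquiv.{u} (oR := oR) 1)) : Type (max (u + 1) v) :=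
  {a : ParamClass.{u} oR // Quot.mk _ a = V₀}

/-- `F` is a finite-type invariant of degree at most `d` on the `Y_1`-equivalence class `V₀`. -/
def IsFiniteType {V₀ : Quot (YEquiv.{u} (oR := oR) 1)} {A : Type*} [AddCommGroup A] (d : ℕ)
    (F : YOneClass V₀ → A) : Prop :=
  ∀ (M : ParamManifold.{u} oR), Quot.mk _ ⟦M⟧ = V₀ →
  ∀ (E : Fin (d + 1) → EmbeddedSurface M),
    Pairwise (fun i j => Disjoint (E i).image (E j).image) →
  ∀ (s : ∀ i, (E i).S.MappingClassGroup), (∀ i, s i ∈ (E i).S.torelli) →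
  ∀ (MJ : Finset (Fin (d + 1)) → YOneClass V₀),
    (∀ J, ∃ N : ParamManifold.{u} oR, ⟦N⟧ = (MJ J).1 ∧
      IsTwist M (fun j : J => E j) (fun j => s j) N) →
  ∑ J : Finset (Fin (d + 1)), (-1 : ℤ) ^ J.card • F (MJ J) = 0

end Twists

end

noncomputable section

/-! ### Positive frames -/

/-! Fix the surface `S` in `M`, thickened to `S × ℝ`. The geometric input is that twisting along `S`
by a product of diffeomorphisms is the same as twisting along parallel copies of `S`, stacked at
heights `0, -1, -2, …`, by the factors (`EmbeddedSurface.IsRegluing.isTwist_shift`). Parallel copies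
are disjoint, so the finite-type condition applies to `d + 1` of them. It says that the function `φ
s = F (M_s)` on the Torelli group, extended linearly to the group ring, kills every product `(1 -
s₀) ⋯ (1 - s_d)`, whose expansion is the alternating sum over subsets. Hence it kills the `(d+1)`-st
power of the augmentation ideal. The algebraic input is the classical inclusion of `Γ_{d+1} - 1` in
that power (`one_sub_of_mem_augmentation_pow`). So `φ a = φ 1` for `a ∈ Γ_{d+1}`, and `φ 1 = F M`.

Two points need care because `IsTwist` is a relation. First, twisted manifolds must exist:
`EmbeddedSurface.exists_isRegluing` builds one by gluing two open pieces of `M` and checks that the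
result is a compact connected Hausdorff oriented manifold with the same boundary parametrization.
Second, `φ` must not depend on the twisted manifold or on the diffeomorphism representing the
mapping class. No geometric uniqueness is proved: in the alternating sum for `(s, 1, …, 1)` only the
term of `{0}` is replaced by a given twist, the others being kept, so the sum determines the value
of `F` there (`IsFiniteType.eq_of_isTwist`). -/

theorem isPositiveFrame_map_of_exists {V W : Type*} [AddCommGroup V] [Module ℝ V]
    [AddCommGroup W] [Module ℝ W] {n : ℕ}
    {o : Orientation ℝ V (Fin n)} {o' : Orientation ℝ W (Fin n)} (L : V ≃ₗ[ℝ] W)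
    {v₀ : Fin n → V} (h₀ : IsPositiveFrame o v₀) (h₁ : IsPositiveFrame o' (fun i => L (v₀ i)))
    {v : Fin n → V} (hv : IsPositiveFrame o v) : IsPositiveFrame o' (fun i => L (v i)) := by
  obtain ⟨b, rfl, hb⟩ := hv
  obtain ⟨b₀, rfl, hb₀⟩ := h₀
  obtain ⟨c, hc, hco⟩ := h₁
  have e : c = b₀.map L := by
    ext i
    rw [hc]
    simp
  rw [e, Module.Basis.orientation_map, hb₀] at hco
  exact ⟨b.map L, by ext i; simp, by rw [Module.Basis.orientation_map, hb, hco]⟩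

theorem exists_isPositiveFrame {V : Type*} [AddCommGroup V] [Module ℝ V] {n : ℕ} [NeZero n]
    (b : Module.Basis (Fin n) ℝ V) (o : Orientation ℝ V (Fin n)) :
    ∃ v, IsPositiveFrame o v :=
  ⟨_, b.adjustToOrientation o, rfl, Module.Basis.orientation_adjustToOrientation _ _⟩

section OrientationPreserving

variable {n : ℕ} {H H' H'' : Type*} [TopologicalSpace H]
  [TopologicalSpace H'] [TopologicalSpace H'']
  {I : ModelWithCorners ℝ (EuclideanSpace ℝ (Fin n)) H}
  {I' : ModelWithCorners ℝ (EuclideanSpace ℝ (Fin n)) H'}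
  {I'' : ModelWithCorners ℝ (EuclideanSpace ℝ (Fin n)) H''}
  {M M' M'' : Type*} [TopologicalSpace M] [ChartedSpace H M]
  [TopologicalSpace M'] [ChartedSpace H' M'] [TopologicalSpace M''] [ChartedSpace H'' M'']
  {o : ManifoldOrientation I M} {o' : ManifoldOrientation I' M'}
  {o'' : ManifoldOrientation I'' M''}

theorem OrientationPreservingAt.comp_of_mdifferentiableAt {g : M' → M''} {f : M → M'} {x : M}
    (hg : MDifferentiableAt I' I'' g (f x)) (hf : MDifferentiableAt I I' f x)
    (hg' : OrientationPreservingAt o' o'' g (f x)) (hf' : OrientationPreservingAt o o' f x) :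
    OrientationPreservingAt o o'' (fun y => g (f y)) x := by
  intro v hv
  have h := hg' _ (hf' v hv)
  have e : mfderiv I I'' (fun y => g (f y)) x
      = (mfderiv I' I'' g (f x)).comp (mfderiv I I' f x) := mfderiv_comp x hg hf
  rw [e]
  exact h

theorem OrientationPreservingAt.congr_of_eventuallyEq {f g : M → M'} {x : M}
    (hf : OrientationPreservingAt o o' f x) (h : g =ᶠ[𝓝 x] f) :
    OrientationPreservingAt o o' g x := by
  intro v hv
  have e : g x = f x := h.eq_of_nhds
  have h1 := hf v hv
  have hd : (mfderiv I I' g x : EuclideanSpace ℝ (Fin n) →L[ℝ] EuclideanSpace ℝ (Fin n))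
      = mfderiv I I' f x := h.mfderiv_eq
  change IsPositiveFrame (V := EuclideanSpace ℝ (Fin n)) (o'.atPoint (g x)) fun i =>
    (mfderiv I I' g x : EuclideanSpace ℝ (Fin n) →L[ℝ] EuclideanSpace ℝ (Fin n)) (v i)
  rw [hd, e]
  exact h1

/-- A local diffeomorphism that carries one positive frame to a positive frame preserves the
orientation. -/
theorem IsLocalDiffeomorphAt.orientationPreservingAt_of_exists {f : M → M'} {x : M}
    (hf : IsLocalDiffeomorphAt I I' ∞ f x) {v₀ : Fin n → TangentSpace I x}
    (h₀ : IsPositiveFrame (o.atPoint x) v₀)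
    (h₁ : IsPositiveFrame (o'.atPoint (f x)) (fun i => mfderiv I I' f x (v₀ i))) :
    OrientationPreservingAt o o' f x := by
  intro v hv
  let L : TangentSpace I x ≃ₗ[ℝ] TangentSpace I' (f x) :=
    (hf.mfderivToContinuousLinearEquiv (by simp)).toLinearEquiv
  have hL : ∀ u, L u = mfderiv I I' f x u := fun u => rfl
  exact isPositiveFrame_map_of_exists L h₀ h₁ hv

end OrientationPreserving

/-! ### Local diffeomorphisms at a point -/

section LocalDiffeomorph

variable {𝕜 : Type*} [NontriviallyNormedField 𝕜]
  {E : Type*} [NormedAddCommGroup E] [NormedSpace 𝕜 E]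
  {F : Type*} [NormedAddCommGroup F] [NormedSpace 𝕜 F]
  {E' : Type*} [NormedAddCommGroup E'] [NormedSpace 𝕜 E']
  {F' : Type*} [NormedAddCommGroup F'] [NormedSpace 𝕜 F']
  {H : Type*} [TopologicalSpace H] {G : Type*} [TopologicalSpace G]
  {H' : Type*} [TopologicalSpace H'] {G' : Type*} [TopologicalSpace G']
  {I : ModelWithCorners 𝕜 E H} {J : ModelWithCorners 𝕜 F G}
  {I' : ModelWithCorners 𝕜 E' H'} {J' : ModelWithCorners 𝕜 F' G'}
  {M : Type*} [TopologicalSpace M] [ChartedSpace H M]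
  {N : Type*} [TopologicalSpace N] [ChartedSpace G N]
  {M' : Type*} [TopologicalSpace M'] [ChartedSpace H' M']
  {N' : Type*} [TopologicalSpace N'] [ChartedSpace G' N']
  {n : WithTop ℕ∞}

theorem IsLocalDiffeomorphAt.congr_of_eventuallyEq {f g : M → N} {x : M}
    (hf : IsLocalDiffeomorphAt I J n f x) (h : g =ᶠ[𝓝 x] f) :
    IsLocalDiffeomorphAt I J n g x := by
  obtain ⟨Φ, hx, hΦ⟩ := hf
  obtain ⟨W, hW, hWo, hxW⟩ := eventually_nhds_iff.mp h
  have ho : IsOpen (Φ.source ∩ W) := Φ.open_source.inter hWo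
  let Ψ : PartialDiffeomorph I J M N n :=
    { toPartialEquiv := Φ.toPartialEquiv.restr W
      open_source := ho
      open_target := by
        have := (Φ.toOpenPartialHomeomorph.restrOpen W hWo).open_target
        exact this
      contMDiffOn_toFun := Φ.contMDiffOn_toFun.mono inter_subset_left
      contMDiffOn_invFun := Φ.contMDiffOn_invFun.mono inter_subset_left }
  exact ⟨Ψ, ⟨hx, hxW⟩, fun y hy => (hW y hy.2).trans (hΦ hy.1)⟩

theorem IsLocalDiffeomorphAt.equiv_symm {f : M ≃ N} {x : M}
    (hf : IsLocalDiffeomorphAt I J n f x) : IsLocalDiffeomorphAt J I n f.symm (f x) := by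
  obtain ⟨Φ, hx, hΦ⟩ := hf
  refine ⟨Φ.symm, ?_, ?_⟩
  · rw [hΦ hx]
    exact Φ.map_source hx
  · intro y hy
    have h1 : Φ.invFun y ∈ Φ.source := Φ.map_target hy
    have h2 : f (Φ.invFun y) = y := (hΦ h1).trans (Φ.right_inv hy)
    exact f.symm_apply_eq.mpr h2.symm

theorem IsLocalDiffeomorphAt.prodMap {f : M → N} {g : M' → N'} {x : M} {y : M'}
    (hf : IsLocalDiffeomorphAt I J n f x) (hg : IsLocalDiffeomorphAt I' J' n g y) :
    IsLocalDiffeomorphAt (I.prod I') (J.prod J') n (Prod.map f g) (x, y) := by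
  obtain ⟨Φ, hx, hΦ⟩ := hf
  obtain ⟨Ψ, hy, hΨ⟩ := hg
  let Θ : PartialDiffeomorph (I.prod I') (J.prod J') (M × M') (N × N') n :=
    { toPartialEquiv := Φ.toPartialEquiv.prod Ψ.toPartialEquiv
      open_source := Φ.open_source.prod Ψ.open_source
      open_target := Φ.open_target.prod Ψ.open_target
      contMDiffOn_toFun := Φ.contMDiffOn_toFun.prodMap Ψ.contMDiffOn_toFun
      contMDiffOn_invFun := Φ.contMDiffOn_invFun.prodMap Ψ.contMDiffOn_invFun }
  exact ⟨Θ, ⟨hx, hy⟩, fun p hp => Prod.ext (hΦ hp.1) (hΨ hp.2)⟩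

theorem IsLocalDiffeomorphAt.map_nhds_eq {f : M → N} {x : M}
    (hf : IsLocalDiffeomorphAt I J n f x) : Filter.map f (𝓝 x) = 𝓝 (f x) := by
  obtain ⟨Φ, hx, hΦ⟩ := hf
  have h1 := Φ.toOpenPartialHomeomorph.map_nhds_eq hx
  have h2 : f =ᶠ[𝓝 x] Φ.toOpenPartialHomeomorph :=
    Filter.eventuallyEq_of_mem (Φ.open_source.mem_nhds hx) hΦ
  rw [Filter.map_congr h2, h1, h2.eq_of_nhds]

/-- Local diffeomorphisms descend along surjective local diffeomorphisms. -/
theorem IsLocalDiffeomorphAt.of_comp {f : M → N} {g : N → M'} {x : M}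
    (hf : IsLocalDiffeomorphAt I J n f x)
    (hgf : IsLocalDiffeomorphAt I I' n (fun y => g (f y)) x) :
    IsLocalDiffeomorphAt J I' n g (f x) := by
  have h1 := hf.localInverse_isLocalDiffeomorphAt
  have hx : hf.localInverse (f x) = x := hf.localInverse_left_inv hf.localInverse_mem_target
  have hgf' : IsLocalDiffeomorphAt I I' n (fun y => g (f y)) (hf.localInverse (f x)) := by
    rw [hx]
    exact hgf
  have h2 := h1.comp I' M' hgf'
  refine h2.congr_of_eventuallyEq ?_
  filter_upwards [hf.localInverse_eventuallyEq_right] with y hy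
  exact congrArg g hy.symm

end LocalDiffeomorph

/-! ### Cutting a manifold and gluing it back -/

/-- The data needed to reglue a manifold `M`: an open cover of `M` by `U` and `V`, and a permutation
of `M` that is a local diffeomorphism on `U ∩ V`. The reglued manifold is obtained from `U` and `V`
by identifying `p ∈ U ∩ V`, as a point of `V`, with `toPerm p`, as a point of `U`. The compact set
`K` contains the complement of `U` in its interior; it makes the result Hausdorff and compact. -/
structure RegluingDatum {E H : Type*} [NormedAddCommGroup E] [NormedSpace ℝ E]
    [TopologicalSpace H] (I : ModelWithCorners ℝ E H)
    (M : Type u) [TopologicalSpace M] [ChartedSpace H M] where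
  toPerm : Equiv.Perm M
  U : Set M
  V : Set M
  K : Set M
  isOpen_U : IsOpen U
  isOpen_V : IsOpen V
  mem_or_mem : ∀ p, p ∈ U ∨ p ∈ V
  mem_V_iff : ∀ p, toPerm p ∈ V ↔ p ∈ V
  mem_U_iff : ∀ p ∈ V, toPerm p ∈ U ↔ p ∈ U
  isLocalDiffeomorphAt : ∀ p ∈ U, p ∈ V → IsLocalDiffeomorphAt I I ∞ toPerm p
  isCompact_K : IsCompact K
  isClosed_K : IsClosed K
  K_subset : K ⊆ V
  compl_U_subset : Uᶜ ⊆ interior K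
  mem_K_iff : ∀ p, toPerm p ∈ K ↔ p ∈ K

namespace RegluingDatum

variable {E H : Type*} [NormedAddCommGroup E] [NormedSpace ℝ E]
    [TopologicalSpace H] {I : ModelWithCorners ℝ E H}
    {M : Type u} [TopologicalSpace M] [ChartedSpace H M] (D : RegluingDatum I M)

theorem symm_mem_V_iff (p : M) : D.toPerm.symm p ∈ D.V ↔ p ∈ D.V := by
  rw [← D.mem_V_iff, Equiv.apply_symm_apply]

theorem symm_mem_U_iff (p : M) (hp : p ∈ D.V) : D.toPerm.symm p ∈ D.U ↔ p ∈ D.U := by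
  rw [← D.mem_U_iff _ ((D.symm_mem_V_iff p).mpr hp), Equiv.apply_symm_apply]

theorem isLocalDiffeomorphAt_symm (p : M) (hU : p ∈ D.U) (hV : p ∈ D.V) :
    IsLocalDiffeomorphAt I I ∞ D.toPerm.symm p := by
  have h := (D.isLocalDiffeomorphAt (D.toPerm.symm p) ((D.symm_mem_U_iff p hV).mpr hU)
    ((D.symm_mem_V_iff p).mpr hV)).equiv_symm
  rwa [Equiv.apply_symm_apply] at h

/-- The points of the reglued manifold. -/
def Space (_D : RegluingDatum I M) : Type u := M

/-- The identity, as a map to the reglued manifold. -/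
def equiv : M ≃ D.Space := Equiv.refl M

/-- The inclusion of `U`, as a partial equivalence with the reglued manifold. -/
def chartU : PartialEquiv D.Space M where
  toFun := D.equiv.symm
  invFun := D.equiv
  source := D.equiv.symm ⁻¹' D.U
  target := D.U
  map_source' := fun _ h => h
  map_target' := fun _ h => h
  left_inv' := fun _ _ => rfl
  right_inv' := fun _ _ => rfl

/-- The inclusion of `V`, as a partial equivalence with the reglued manifold. -/
def chartV : PartialEquiv D.Space M where
  toFun := fun p => D.toPerm.symm (D.equiv.symm p)
  invFun := fun p => D.equiv (D.toPerm p)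
  source := D.equiv.symm ⁻¹' D.V
  target := D.V
  map_source' := fun _ h => (D.symm_mem_V_iff _).mpr h
  map_target' := fun p h => (D.mem_V_iff p).mpr h
  left_inv' := fun p _ => D.toPerm.apply_symm_apply (D.equiv.symm p)
  right_inv' := fun p _ => D.toPerm.symm_apply_apply p

open Classical in
/-- The preferred chart at a point. -/
def pieceAt (p : D.Space) : PartialEquiv D.Space M :=
  if D.equiv.symm p ∈ D.U then D.chartU else D.chartV

theorem pieceAt_mem (p : D.Space) : D.pieceAt p = D.chartU ∨ D.pieceAt p = D.chartV := by
  unfold pieceAt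
  split_ifs <;> simp

/-- Between different pieces the transition is `toPerm` or its inverse on `U ∩ V`, where it is a
local diffeomorphism by hypothesis; within one piece it is the identity. -/
theorem transition (e e' : PartialEquiv D.Space M) (he : e = D.chartU ∨ e = D.chartV)
    (he' : e' = D.chartU ∨ e' = D.chartV) : IsOpen (e.symm.trans e').source ∧
    ∀ p ∈ (e.symm.trans e').source, IsLocalDiffeomorphAt I I ∞ (e.symm.trans e') p := by
  have hid : ∀ p, IsLocalDiffeomorphAt I I ∞ (fun q : M => q) p :=
    fun p => (Diffeomorph.refl I M ∞).isLocalDiffeomorph p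
  rcases he with rfl | rfl <;> rcases he' with rfl | rfl
  · have e : (D.chartU.symm.trans D.chartU).source = D.U := by
      ext p
      exact ⟨fun h => h.1, fun h => ⟨h, h⟩⟩
    rw [e]
    exact ⟨D.isOpen_U, fun p _ => hid p⟩
  · have e : (D.chartU.symm.trans D.chartV).source = D.U ∩ D.V := by
      ext p
      exact ⟨fun h => ⟨h.1, h.2⟩, fun h => ⟨h.1, h.2⟩⟩
    rw [e]
    exact ⟨D.isOpen_U.inter D.isOpen_V, fun p h => D.isLocalDiffeomorphAt_symm p h.1 h.2⟩
  · have e : (D.chartV.symm.trans D.chartU).source = D.U ∩ D.V := by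
      ext p
      exact ⟨fun h => ⟨(D.mem_U_iff p h.1).mp h.2, h.1⟩,
        fun h => ⟨h.2, (D.mem_U_iff p h.2).mpr h.1⟩⟩
    rw [e]
    exact ⟨D.isOpen_U.inter D.isOpen_V, fun p h => D.isLocalDiffeomorphAt p h.1 h.2⟩
  · have e : (D.chartV.symm.trans D.chartV).source = D.V := by
      ext p
      exact ⟨fun h => h.1, fun h => ⟨h, (D.mem_V_iff p).mpr h⟩⟩
    rw [e]
    refine ⟨D.isOpen_V, fun p _ => (hid p).congr_of_eventuallyEq (Filter.Eventually.of_forall ?_)⟩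
    exact fun q => D.toPerm.symm_apply_apply q

/-- The reglued manifold as a space locally modelled on `M`. -/
def core : ChartedSpaceCore M D.Space where
  atlas := {e | e = D.chartU ∨ e = D.chartV}
  chartAt := D.pieceAt
  mem_chart_source := by
    intro p
    unfold pieceAt
    split_ifs with h
    · exact h
    · exact (D.mem_or_mem (D.equiv.symm p)).resolve_left h
  chart_mem_atlas := D.pieceAt_mem
  open_source := fun e e' he he' => (D.transition e e' he he').1
  continuousOn_toFun := fun e e' he he' p hp =>
    ((D.transition e e' he he').2 p hp).contMDiffAt.continuousAt.continuousWithinAt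

instance : TopologicalSpace D.Space := D.core.toTopologicalSpace

instance : ChartedSpace H D.Space :=
  @ChartedSpace.comp H _ M _ D.Space _ _ D.core.toChartedSpace

/-- The piece of the reglued manifold given by `U`. -/
def pieceU : OpenPartialHomeomorph D.Space M := D.core.openPartialHomeomorph D.chartU (Or.inl rfl)

/-- The piece of the reglued manifold given by `V`. -/
def pieceV : OpenPartialHomeomorph D.Space M := D.core.openPartialHomeomorph D.chartV (Or.inr rfl)

/-- The preferred piece at a point. -/
def piece (p : D.Space) : OpenPartialHomeomorph D.Space M :=
  D.core.openPartialHomeomorph (D.pieceAt p) (D.pieceAt_mem p)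

theorem mem_piece_source (p : D.Space) : p ∈ (D.piece p).source := D.core.mem_chart_source p

theorem piece_eq_pieceU {p : D.Space} (hp : D.equiv.symm p ∈ D.U) : D.piece p = D.pieceU := by
  have h : D.pieceAt p = D.chartU := if_pos hp
  unfold piece pieceU
  congr 1

theorem piece_eq_pieceV {p : D.Space} (hp : D.equiv.symm p ∉ D.U) : D.piece p = D.pieceV := by
  have h : D.pieceAt p = D.chartV := if_neg hp
  unfold piece pieceV
  congr 1

theorem mem_atlas_iff (c : OpenPartialHomeomorph D.Space H) :
    c ∈ atlas H D.Space ↔ ∃ e, (e = D.pieceU ∨ e = D.pieceV) ∧ ∃ c' ∈ atlas H M,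
      e.trans c' = c := by
  change c ∈ image2 OpenPartialHomeomorph.trans _ _ ↔ _
  simp only [mem_image2]
  constructor
  · rintro ⟨e, he, c', hc', rfl⟩
    refine ⟨e, ?_, c', hc', rfl⟩
    change e ∈ ⋃ (e : PartialEquiv D.Space M) (he : e ∈ D.core.atlas), _ at he
    simp only [mem_iUnion, mem_singleton_iff] at he
    obtain ⟨e', he' | he', rfl⟩ := he
    · subst he'
      exact Or.inl rfl
    · subst he'
      exact Or.inr rfl
  · rintro ⟨e, he, c', hc', rfl⟩
    refine ⟨e, ?_, c', hc', rfl⟩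
    change e ∈ ⋃ (e : PartialEquiv D.Space M) (he : e ∈ D.core.atlas), _
    simp only [mem_iUnion, mem_singleton_iff]
    rcases he with rfl | rfl
    · exact ⟨_, Or.inl rfl, rfl⟩
    · exact ⟨_, Or.inr rfl, rfl⟩

theorem piece_transition {e e' : OpenPartialHomeomorph D.Space M} (he : e = D.pieceU ∨ e = D.pieceV)
    (he' : e' = D.pieceU ∨ e' = D.pieceV) {p : M} (hp : p ∈ (e.symm.trans e').source) :
    IsLocalDiffeomorphAt I I ∞ (e.symm.trans e') p := by
  rcases he with rfl | rfl <;> rcases he' with rfl | rfl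
  · exact (D.transition _ _ (.inl rfl) (.inl rfl)).2 p hp
  · exact (D.transition _ _ (.inl rfl) (.inr rfl)).2 p hp
  · exact (D.transition _ _ (.inr rfl) (.inl rfl)).2 p hp
  · exact (D.transition _ _ (.inr rfl) (.inr rfl)).2 p hp

/-- Charts are composites of a piece with a chart of `M`, so a coordinate change is a transition of
pieces read in charts of `M`. -/
instance [IsManifold I ∞ M] : IsManifold I ∞ D.Space := by
  refine isManifold_of_contDiffOn I ∞ D.Space ?_
  intro c c' hc hc'
  obtain ⟨e, he, a, ha, rfl⟩ := (D.mem_atlas_iff c).mp hc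
  obtain ⟨e', he', a', ha', rfl⟩ := (D.mem_atlas_iff c').mp hc'
  rw [← contMDiffOn_iff_contDiffOn]
  rintro y ⟨hy, z, rfl⟩
  rw [mem_preimage, I.left_inv] at hy
  simp only [mfld_simps] at hy
  obtain ⟨⟨hz, hze⟩, hze', hza'⟩ := hy
  have h1 : ContMDiffWithinAt 𝓘(ℝ, E) I ∞ (a.extend I).symm (I '' a.target) (I z) :=
    contMDiffOn_extend_symm (IsManifold.subset_maximalAtlas ha) _ (mem_image_of_mem I hz)
  have hpt : (a.extend I).symm (I z) = a.symm z := by simp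
  have h2 : ContMDiffAt I I ∞ (e.symm.trans e') (a.symm z) :=
    (D.piece_transition he he' ⟨hze, hze'⟩).contMDiffAt
  have h3 : ContMDiffAt I 𝓘(ℝ, E) ∞ (a'.extend I) (e.symm.trans e' (a.symm z)) :=
    a'.contMDiffAt_extend (IsManifold.subset_maximalAtlas ha') hza'
  have h4 : ContMDiffWithinAt 𝓘(ℝ, E) 𝓘(ℝ, E) ∞
      (a'.extend I ∘ (e.symm.trans e') ∘ (a.extend I).symm) (I '' a.target) (I z) := by
    have h12 : ContMDiffWithinAt 𝓘(ℝ, E) I ∞ ((e.symm.trans e') ∘ (a.extend I).symm)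
        (I '' a.target) (I z) :=
      ContMDiffAt.comp_contMDiffWithinAt (I z) (by rwa [hpt]) h1
    exact ContMDiffAt.comp_contMDiffWithinAt (I z) (by rwa [Function.comp_apply, hpt]) h12
  refine h4.mono ?_
  rintro _ ⟨hw, w, rfl⟩
  rw [mem_preimage, I.left_inv] at hw
  simp only [mfld_simps] at hw
  exact mem_image_of_mem I hw.1.1

theorem contMDiffOn_piece [IsManifold I ∞ M] {e : OpenPartialHomeomorph D.Space M}
    (he : e = D.pieceU ∨ e = D.pieceV) : ContMDiffOn I I ∞ e e.source := by
  intro p hp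
  let c := chartAt H (e p)
  have hc : c ∈ atlas H M := chart_mem_atlas H (e p)
  have hec : e.trans c ∈ atlas H D.Space := (D.mem_atlas_iff _).mpr ⟨e, he, c, hc, rfl⟩
  have hpc : p ∈ (e.trans c).source := by
    rw [OpenPartialHomeomorph.trans_source]
    exact ⟨hp, mem_chart_source H (e p)⟩
  have h1 : ContMDiffOn I 𝓘(ℝ, E) ∞ ((e.trans c).extend I) (e.trans c).source :=
    (e.trans c).contMDiffOn_extend (IsManifold.subset_maximalAtlas hec)
  have h2 : ContMDiffOn 𝓘(ℝ, E) I ∞ (c.extend I).symm (I '' c.target) :=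
    contMDiffOn_extend_symm (IsManifold.subset_maximalAtlas hc)
  have h3 := h2.comp h1 (fun q hq => by
    simp only [OpenPartialHomeomorph.trans_source, mem_inter_iff, mem_preimage] at hq
    exact mem_image_of_mem I (c.map_source hq.2))
  have h4 : ContMDiffOn I I ∞ e (e.trans c).source := by
    refine h3.congr fun q hq => ?_
    simp only [OpenPartialHomeomorph.trans_source, mem_inter_iff, mem_preimage] at hq
    simp [hq.2]
  exact (h4.contMDiffAt ((e.trans c).open_source.mem_nhds hpc)).contMDiffWithinAt

theorem contMDiffOn_piece_symm [IsManifold I ∞ M] {e : OpenPartialHomeomorph D.Space M}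
    (he : e = D.pieceU ∨ e = D.pieceV) : ContMDiffOn I I ∞ e.symm e.target := by
  intro p hp
  let c := chartAt H p
  have hc : c ∈ atlas H M := chart_mem_atlas H p
  have hec : e.trans c ∈ atlas H D.Space := (D.mem_atlas_iff _).mpr ⟨e, he, c, hc, rfl⟩
  have ho : IsOpen (e.target ∩ c.source) := e.open_target.inter c.open_source
  have h1 : ContMDiffOn I 𝓘(ℝ, E) ∞ (c.extend I) (e.target ∩ c.source) :=
    (c.contMDiffOn_extend (IsManifold.subset_maximalAtlas hc)).mono inter_subset_right
  have h2 : ContMDiffOn 𝓘(ℝ, E) I ∞ ((e.trans c).extend I).symm (I '' (e.trans c).target) :=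
    contMDiffOn_extend_symm (IsManifold.subset_maximalAtlas hec)
  have h3 := h2.comp h1 (fun q hq => by
    refine mem_image_of_mem I ?_
    simp [hq.1, hq.2])
  have h4 : ContMDiffOn I I ∞ e.symm (e.target ∩ c.source) := by
    refine h3.congr fun q hq => ?_
    simp [hq.2]
  exact (h4.contMDiffAt (ho.mem_nhds ⟨hp, mem_chart_source H p⟩)).contMDiffWithinAt

theorem isLocalDiffeomorphAt_piece [IsManifold I ∞ M] {e : OpenPartialHomeomorph D.Space M}
    (he : e = D.pieceU ∨ e = D.pieceV) {p : D.Space} (hp : p ∈ e.source) :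
    IsLocalDiffeomorphAt I I ∞ e p :=
  ⟨{ toPartialEquiv := e.toPartialEquiv
     open_source := e.open_source
     open_target := e.open_target
     contMDiffOn_toFun := D.contMDiffOn_piece he
     contMDiffOn_invFun := D.contMDiffOn_piece_symm he }, hp, fun _ _ => rfl⟩

theorem isLocalDiffeomorphAt_piece_symm [IsManifold I ∞ M] {e : OpenPartialHomeomorph D.Space M}
    (he : e = D.pieceU ∨ e = D.pieceV) {p : M} (hp : p ∈ e.target) :
    IsLocalDiffeomorphAt I I ∞ e.symm p :=
  ⟨{ toPartialEquiv := e.symm.toPartialEquiv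
     open_source := e.open_target
     open_target := e.open_source
     contMDiffOn_toFun := D.contMDiffOn_piece_symm he
     contMDiffOn_invFun := D.contMDiffOn_piece he }, hp, fun _ _ => rfl⟩

theorem piece_mem (p : D.Space) : D.piece p = D.pieceU ∨ D.piece p = D.pieceV := by
  by_cases h : D.equiv.symm p ∈ D.U
  · exact Or.inl (D.piece_eq_pieceU h)
  · exact Or.inr (D.piece_eq_pieceV h)

/-- The identity of `M` is a local diffeomorphism to the reglued manifold on `U`. -/
theorem isLocalDiffeomorphAt_equiv [IsManifold I ∞ M] {p : M} (hp : p ∈ D.U) :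
    IsLocalDiffeomorphAt I I ∞ D.equiv p :=
  D.isLocalDiffeomorphAt_piece_symm (e := D.pieceU) (Or.inl rfl) hp

/-- The permutation is a local diffeomorphism to the reglued manifold on `V`. -/
theorem isLocalDiffeomorphAt_equiv_toPerm [IsManifold I ∞ M] {p : M} (hp : p ∈ D.V) :
    IsLocalDiffeomorphAt I I ∞ (fun q => D.equiv (D.toPerm q)) p :=
  D.isLocalDiffeomorphAt_piece_symm (e := D.pieceV) (Or.inr rfl) hp

theorem _root_.HasFDerivWithinAt.id_of_eventuallyEq {f : E → E} {s : Set E} {x : E} (hx : x ∈ s)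
    (h : ∀ᶠ y in 𝓝[s] x, f y = y) : HasFDerivWithinAt f (ContinuousLinearMap.id ℝ E) s x :=
  (hasFDerivWithinAt_id x s).congr_of_eventuallyEq h (h.self_of_nhdsWithin hx)

/-- The preferred chart at `p` is the preferred piece followed by a chart of `M`, so in coordinates
the piece is the identity. Tangent vectors at `p` and at its image in `M` are thereby literally the
same vectors. -/
theorem hasMFDerivAt_piece (p : D.Space) :
    HasMFDerivAt I I (D.piece p) p (ContinuousLinearMap.id ℝ E) := by
  refine ⟨(D.piece p).continuousAt (D.mem_piece_source p), ?_⟩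
  refine HasFDerivWithinAt.id_of_eventuallyEq (mem_range_self _) ?_
  filter_upwards [extChartAt_target_mem_nhdsWithin (I := I) p] with y hy
  exact (extChartAt I p).right_inv hy

/-- `pieceAt` prefers `U` whenever it can, so at a point of `U` both sides use the same chart of
`M`. This lets the orientation of the boundary parametrization carry over unchanged. -/
theorem hasMFDerivAt_equiv [IsManifold I ∞ M] {p : M} (hp : p ∈ D.U) :
    HasMFDerivAt I I D.equiv p (ContinuousLinearMap.id ℝ E) := by
  refine ⟨(D.isLocalDiffeomorphAt_equiv hp).contMDiffAt.continuousAt, ?_⟩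
  refine HasFDerivWithinAt.id_of_eventuallyEq (mem_range_self _) ?_
  filter_upwards [extChartAt_target_mem_nhdsWithin (I := I) p] with y hy
  have h : D.piece (D.equiv p) = D.pieceU := D.piece_eq_pieceU hp
  have h2 : extChartAt I (D.equiv p)
      = ((D.piece (D.equiv p)).trans (chartAt H (D.piece (D.equiv p) (D.equiv p)))).extend I := rfl
  simp only [writtenInExtChartAt, h2, h]
  exact (extChartAt I p).right_inv hy

theorem isOpen_image_of_subset_U {A : Set M} (hA : IsOpen A) (h : A ⊆ D.U) :
    IsOpen (D.equiv '' A) :=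
  D.pieceU.symm.isOpen_image_of_subset_source hA h

theorem isOpen_image_of_subset_V {A : Set M} (hA : IsOpen A) (h : A ⊆ D.V) :
    IsOpen ((fun q => D.equiv (D.toPerm q)) '' A) :=
  D.pieceV.symm.isOpen_image_of_subset_source hA h

/-- Invariance of `K` under `toPerm` makes `K` the same subset whether seen through `V` or through
the identity; compactness and separation both rest on this. -/
theorem image_K : (fun q => D.equiv (D.toPerm q)) '' D.K = D.equiv '' D.K := by
  ext p
  constructor
  · rintro ⟨q, hq, rfl⟩
    exact ⟨_, (D.mem_K_iff q).mpr hq, rfl⟩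
  · rintro ⟨q, hq, rfl⟩
    refine ⟨D.toPerm.symm q, ?_, ?_⟩
    · rwa [← D.mem_K_iff, Equiv.apply_symm_apply]
    · simp

theorem continuousOn_equiv : ContinuousOn D.equiv D.U := D.pieceU.symm.continuousOn

theorem continuousOn_equiv_toPerm : ContinuousOn (fun q => D.equiv (D.toPerm q)) D.V :=
  D.pieceV.symm.continuousOn

/-- The space is covered by two compact sets: the complement of the interior of `K`, seen through
`U`, and `K`, seen through `V`. -/
instance [CompactSpace M] : CompactSpace D.Space := by
  have h1 : IsCompact (D.equiv '' (interior D.K)ᶜ) := by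
    refine isOpen_interior.isClosed_compl.isCompact.image_of_continuousOn
      (D.continuousOn_equiv.mono ?_)
    rw [compl_subset_comm]
    exact D.compl_U_subset
  have h2 : IsCompact (D.equiv '' D.K) := by
    rw [← D.image_K]
    exact D.isCompact_K.image_of_continuousOn (D.continuousOn_equiv_toPerm.mono D.K_subset)
  refine ⟨(h1.union h2).of_isClosed_subset isClosed_univ ?_⟩
  rintro p -
  by_cases hp : D.equiv.symm p ∈ interior D.K
  · exact Or.inr ⟨_, interior_subset hp, D.equiv.apply_symm_apply p⟩
  · exact Or.inl ⟨_, hp, D.equiv.apply_symm_apply p⟩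

/-- Two points in a common piece are separated there. The remaining case is a point outside `V` and
a point outside `U`: the first lies in `U \ K`, the second in the image of the interior of `K` under
the gluing map. -/
instance [T2Space M] : T2Space D.Space := by
  have key : ∀ {x y : M}, x ∈ D.U → x ∉ D.V → y ∉ D.U →
      ∃ u v : Set D.Space, IsOpen u ∧ IsOpen v ∧ D.equiv x ∈ u ∧ D.equiv y ∈ v ∧ Disjoint u v := by
    intro x y hxU hxV hyU
    have hyV : y ∈ D.V := (D.mem_or_mem y).resolve_left hyU
    have hy : D.toPerm.symm y ∈ interior D.K := by
      apply D.compl_U_subset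
      rwa [mem_compl_iff, D.symm_mem_U_iff y hyV]
    refine ⟨D.equiv '' (D.U \ D.K), (fun q => D.equiv (D.toPerm q)) '' interior D.K,
      D.isOpen_image_of_subset_U (D.isOpen_U.sdiff D.isClosed_K) sdiff_subset,
      D.isOpen_image_of_subset_V isOpen_interior (interior_subset.trans D.K_subset),
      mem_image_of_mem _ ⟨hxU, fun h => hxV (D.K_subset h)⟩, ⟨_, hy, by simp⟩, ?_⟩
    have h1 : Disjoint (D.equiv '' (D.U \ D.K)) (D.equiv '' D.K) :=
      (disjoint_image_iff D.equiv.injective).mpr disjoint_sdiff_left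
    refine h1.mono_right ?_
    rw [← D.image_K]
    exact image_mono interior_subset
  refine ⟨fun p q hpq => ?_⟩
  obtain ⟨x, rfl⟩ := D.equiv.surjective p
  obtain ⟨y, rfl⟩ := D.equiv.surjective q
  have hxy : x ≠ y := fun h => hpq (congrArg _ h)
  by_cases hV : x ∈ D.V ∧ y ∈ D.V
  · obtain ⟨u, v, hu, hv, hxu, hyv, huv⟩ := t2_separation (D.toPerm.symm.injective.ne hxy)
    refine ⟨_, _, D.isOpen_image_of_subset_V (hu.inter D.isOpen_V) inter_subset_right,
      D.isOpen_image_of_subset_V (hv.inter D.isOpen_V) inter_subset_right,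
      ⟨_, ⟨hxu, (D.symm_mem_V_iff x).mpr hV.1⟩, by simp⟩,
      ⟨_, ⟨hyv, (D.symm_mem_V_iff y).mpr hV.2⟩, by simp⟩, ?_⟩
    exact (disjoint_image_iff (D.equiv.injective.comp D.toPerm.injective)).mpr
      (huv.mono inter_subset_left inter_subset_left)
  · by_cases hxU : x ∈ D.U
    · by_cases hyU : y ∈ D.U
      · obtain ⟨u, v, hu, hv, hxu, hyv, huv⟩ := t2_separation hxy
        refine ⟨_, _, D.isOpen_image_of_subset_U (hu.inter D.isOpen_U) inter_subset_right,
          D.isOpen_image_of_subset_U (hv.inter D.isOpen_U) inter_subset_right,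
          ⟨_, ⟨hxu, hxU⟩, rfl⟩, ⟨_, ⟨hyv, hyU⟩, rfl⟩, ?_⟩
        exact (disjoint_image_iff D.equiv.injective).mpr
          (huv.mono inter_subset_left inter_subset_left)
      · exact key hxU (fun h => hV ⟨h, (D.mem_or_mem y).resolve_left hyU⟩) hyU
    · have hxV : x ∈ D.V := (D.mem_or_mem x).resolve_left hxU
      have hyV : y ∉ D.V := fun h => hV ⟨hxV, h⟩
      obtain ⟨u, v, hu, hv, h1, h2, h3⟩ := key ((D.mem_or_mem y).resolve_right hyV) hyV hxU
      exact ⟨v, u, hv, hu, h2, h1, h3.symm⟩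

/-- A clopen set containing the image of `V` pulls back to a clopen set of `M`, since openness has
to be checked only on `U` and on `V`. The connected set `T` forces any clopen set, or its
complement, to contain that image. -/
theorem connectedSpace [ConnectedSpace M] {T : Set D.Space} (hT : IsPreconnected T)
    (hVT : D.equiv '' D.V ⊆ T) : ConnectedSpace D.Space := by
  have key : ∀ W : Set D.Space, IsClopen W → T ⊆ W → W = univ ∨ W = ∅ := by
    intro W hW hTW
    have hVW : ∀ p ∈ D.V, D.equiv p ∈ W := fun p hp => hTW (hVT (mem_image_of_mem _ hp))
    have h1 : IsOpen (D.equiv ⁻¹' W) := by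
      have e : D.equiv ⁻¹' W = (D.U ∩ D.equiv ⁻¹' W) ∪ D.V := by
        ext p
        have := D.mem_or_mem p
        have := hVW p
        simp only [mem_preimage, mem_union, mem_inter_iff]
        tauto
      rw [e]
      exact (D.continuousOn_equiv.isOpen_inter_preimage D.isOpen_U hW.isOpen).union D.isOpen_V
    have h2 : IsOpen (D.equiv ⁻¹' W)ᶜ := by
      have e : (D.equiv ⁻¹' W)ᶜ = D.U ∩ D.equiv ⁻¹' Wᶜ := by
        ext p
        have := D.mem_or_mem p
        have := hVW p
        simp only [mem_preimage, mem_compl_iff, mem_inter_iff]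
        tauto
      rw [e]
      exact D.continuousOn_equiv.isOpen_inter_preimage D.isOpen_U hW.compl.isOpen
    rcases isClopen_iff.mp (⟨⟨h2⟩, h1⟩ : IsClopen (D.equiv ⁻¹' W)) with h | h
    · right
      rwa [preimage_eq_empty_iff, D.equiv.surjective.range_eq, disjoint_univ] at h
    · left
      exact eq_univ_of_forall fun p => by
        obtain ⟨x, rfl⟩ := D.equiv.surjective p
        exact (h ▸ mem_univ x : x ∈ D.equiv ⁻¹' W)
  have : PreconnectedSpace D.Space := by
    rw [preconnectedSpace_iff_clopen]
    intro W hW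
    by_cases hTW : (T ∩ W).Nonempty
    · exact (key W hW (hT.subset_isClopen hW hTW)).symm
    · have h : T ⊆ Wᶜ := fun x hx hxW => hTW ⟨x, hx, hxW⟩
      rcases key Wᶜ hW.compl h with h | h
      · exact Or.inl (compl_univ_iff.mp h)
      · exact Or.inr (compl_empty_iff.mp h)
  have : Nonempty D.Space := ConnectedSpace.toNonempty (α := M)
  exact ⟨this⟩

end RegluingDatum

theorem OrientationPreservingAt.equiv_symm {n : ℕ} [NeZero n] {H H' : Type*} [TopologicalSpace H]
    [TopologicalSpace H']
    {I : ModelWithCorners ℝ (EuclideanSpace ℝ (Fin n)) H}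
    {I' : ModelWithCorners ℝ (EuclideanSpace ℝ (Fin n)) H'}
    {M M' : Type*} [TopologicalSpace M] [ChartedSpace H M]
    [TopologicalSpace M'] [ChartedSpace H' M']
    {o : ManifoldOrientation I M} {o' : ManifoldOrientation I' M'} {f : M ≃ M'} {x : M}
    (hf : OrientationPreservingAt o o' f x) (hfd : IsLocalDiffeomorphAt I I' ∞ f x) :
    OrientationPreservingAt o' o f.symm (f x) := by
  obtain ⟨v₀, hv₀⟩ := exists_isPositiveFrame
    (V := TangentSpace I x) (PiLp.basisFun 2 ℝ (Fin n)) (o.atPoint x)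
  refine hfd.equiv_symm.orientationPreservingAt_of_exists (hf v₀ hv₀) ?_
  have h1 : mfderiv I I (fun y => f.symm (f y)) x
      = (mfderiv I' I f.symm (f x)).comp (mfderiv I I' f x) :=
    mfderiv_comp x (hfd.equiv_symm.contMDiffAt.mdifferentiableAt (by simp))
      (hfd.contMDiffAt.mdifferentiableAt (by simp))
  have h2 : (fun y => f.symm (f y)) = (fun y : M => y) := by ext; simp
  have h3 : mfderiv I I (fun y => f.symm (f y)) x = ContinuousLinearMap.id ℝ _ := by
    rw [h2]; exact mfderiv_id
  have h4 : (fun i => (mfderiv I' I f.symm (f x) (mfderiv I I' f x (v₀ i)) :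
      EuclideanSpace ℝ (Fin n))) = v₀ := funext fun i =>
    congrArg (fun T : TangentSpace I x →L[ℝ] TangentSpace I x => T (v₀ i)) (h1.symm.trans h3)
  have hx : ∀ x' : M, x' = x → IsPositiveFrame (V := TangentSpace I x') (o.atPoint x')
      (fun i => (v₀ i : EuclideanSpace ℝ (Fin n))) := by
    rintro _ rfl
    exact hv₀
  exact (congrArg (IsPositiveFrame (V := EuclideanSpace ℝ (Fin n)) (o.atPoint (f.symm (f x))))
    h4).mpr (hx _ (f.symm_apply_apply x))

/-! ### Orientation of the reglued manifold -/

namespace RegluingDatum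

variable {n : ℕ} [NeZero n] {H : Type*} [TopologicalSpace H]
  {I : ModelWithCorners ℝ (EuclideanSpace ℝ (Fin n)) H}
  {M : Type u} [TopologicalSpace M] [ChartedSpace H M] (D : RegluingDatum I M)

variable {o : ManifoldOrientation I M}

theorem piece_transition_orientationPreservingAt
    (ho : ∀ p ∈ D.U, p ∈ D.V → OrientationPreservingAt o o D.toPerm p)
    {e e' : OpenPartialHomeomorph D.Space M} (he : e = D.pieceU ∨ e = D.pieceV)
    (he' : e' = D.pieceU ∨ e' = D.pieceV) {p : M} (hp : p ∈ (e.symm.trans e').source) :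
    OrientationPreservingAt o o (e.symm.trans e') p := by
  rcases he with rfl | rfl <;> rcases he' with rfl | rfl
  · exact orientationPreservingAt_id o p
  · have hU : p ∈ D.U := hp.1
    have hV : p ∈ D.V := hp.2
    have hU' := (D.symm_mem_U_iff p hV).mpr hU
    have hV' := (D.symm_mem_V_iff p).mpr hV
    have h := (ho _ hU' hV').equiv_symm (D.isLocalDiffeomorphAt _ hU' hV')
    rw [Equiv.apply_symm_apply] at h
    exact h
  · exact ho p ((D.mem_U_iff p hp.1).mp hp.2) hp.1
  · refine (orientationPreservingAt_id o p).congr_of_eventuallyEq (Filter.Eventually.of_forall ?_)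
    exact fun q => D.toPerm.symm_apply_apply q

/-- The preferred piece has identity derivative at `p`, so the derivative of any piece `e` there is
that of the transition between the two, which preserves `o`. -/
theorem isPositiveFrame_piece [IsManifold I ∞ M]
    (ho : ∀ p ∈ D.U, p ∈ D.V → OrientationPreservingAt o o D.toPerm p)
    {e : OpenPartialHomeomorph D.Space M} (he : e = D.pieceU ∨ e = D.pieceV) {p : D.Space}
    (hp : p ∈ e.source) (v : Fin n → EuclideanSpace ℝ (Fin n))
    (hv : IsPositiveFrame (V := EuclideanSpace ℝ (Fin n)) (o.atPoint (D.piece p p)) v) :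
    IsPositiveFrame (V := EuclideanSpace ℝ (Fin n)) (o.atPoint (e p))
      (fun i => mfderiv I I e p (v i)) := by
  have hps : D.piece p p ∈ ((D.piece p).symm.trans e).source := by
    rw [OpenPartialHomeomorph.trans_source]
    refine ⟨(D.piece p).map_source (D.mem_piece_source p), ?_⟩
    rw [mem_preimage, (D.piece p).left_inv (D.mem_piece_source p)]
    exact hp
  have h1 : e =ᶠ[𝓝 p] fun q => ((D.piece p).symm.trans e) (D.piece p q) := by
    filter_upwards [(D.piece p).open_source.mem_nhds (D.mem_piece_source p)] with q hq
    rw [OpenPartialHomeomorph.coe_trans, Function.comp_apply, (D.piece p).left_inv hq]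
  have h2 : HasMFDerivAt I I (fun q => ((D.piece p).symm.trans e) (D.piece p q)) p
      ((mfderiv I I ((D.piece p).symm.trans e) (D.piece p p)).comp
        (ContinuousLinearMap.id ℝ (EuclideanSpace ℝ (Fin n)))) :=
    HasMFDerivAt.comp p ((D.piece_transition (D.piece_mem p) he hps).contMDiffAt.mdifferentiableAt
      (by simp)).hasMFDerivAt (D.hasMFDerivAt_piece p)
  have h3 := D.piece_transition_orientationPreservingAt ho (D.piece_mem p) he hps v hv
  have h4 : (mfderiv I I e p : EuclideanSpace ℝ (Fin n) →L[ℝ] EuclideanSpace ℝ (Fin n)) =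
      mfderiv I I ((D.piece p).symm.trans e) (D.piece p p) :=
    (h2.congr_of_eventuallyEq h1).mfderiv.trans (ContinuousLinearMap.comp_id _)
  have h5 : ((D.piece p).symm.trans e) (D.piece p p) = e p := h1.eq_of_nhds.symm
  change IsPositiveFrame (V := EuclideanSpace ℝ (Fin n)) _ fun i =>
    (mfderiv I I e p : EuclideanSpace ℝ (Fin n) →L[ℝ] EuclideanSpace ℝ (Fin n)) (v i)
  rw [h4]
  rw [h5] at h3
  exact h3

/-- The orientation of the reglued manifold. -/
def orientation [IsManifold I ∞ M]
    (ho : ∀ p ∈ D.U, p ∈ D.V → OrientationPreservingAt o o D.toPerm p) :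
    ManifoldOrientation I D.Space where
  -- The orientation can be copied without transport because the preferred piece has identity
  -- derivative.
  atPoint p := (o.atPoint (D.piece p p) : Orientation ℝ (EuclideanSpace ℝ (Fin n)) (Fin n))
  locally_constant := by
    intro p₀
    obtain ⟨o₀, h⟩ := o.locally_constant (D.piece p₀ p₀)
    refine ⟨o₀, ?_⟩
    have hc := (D.piece p₀).continuousAt (D.mem_piece_source p₀)
    filter_upwards [hc.eventually h, hc.eventually (extChartAt_source_mem_nhds (I := I) _),
      (D.piece p₀).open_source.mem_nhds (D.mem_piece_source p₀)] with p hp hpc hps v hv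
    have h1 := hp _ (D.isPositiveFrame_piece ho (D.piece_mem p₀) hps v hv)
    have h2 : extChartAt I p₀ = fun q => extChartAt I (D.piece p₀ p₀) (D.piece p₀ q) := rfl
    have h3 : mfderiv I 𝓘(ℝ, EuclideanSpace ℝ (Fin n))
        (fun q => extChartAt I (D.piece p₀ p₀) (D.piece p₀ q)) p
        = (mfderiv I 𝓘(ℝ, EuclideanSpace ℝ (Fin n)) (extChartAt I (D.piece p₀ p₀))
          (D.piece p₀ p)).comp (mfderiv I I (D.piece p₀) p) :=
      mfderiv_comp p ((contMDiffAt_extChartAt' (n := ∞) (by rw [← extChartAt_source I]; exact hpc)).mdifferentiableAt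
        (by simp)) ((D.isLocalDiffeomorphAt_piece (D.piece_mem p₀)
          hps).contMDiffAt.mdifferentiableAt (by simp))
    rw [h2, h3]
    exact h1

theorem orientationPreservingAt_piece [IsManifold I ∞ M]
    (ho : ∀ p ∈ D.U, p ∈ D.V → OrientationPreservingAt o o D.toPerm p)
    {e : OpenPartialHomeomorph D.Space M} (he : e = D.pieceU ∨ e = D.pieceV) {p : D.Space}
    (hp : p ∈ e.source) : OrientationPreservingAt (D.orientation ho) o e p :=
  D.isPositiveFrame_piece ho he hp

theorem orientationPreservingAt_equiv [IsManifold I ∞ M]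
    (ho : ∀ p ∈ D.U, p ∈ D.V → OrientationPreservingAt o o D.toPerm p) {p : M} (hp : p ∈ D.U) :
    OrientationPreservingAt o (D.orientation ho) D.equiv p :=
  OrientationPreservingAt.equiv_symm (f := D.equiv.symm) (x := D.equiv p)
    (D.orientationPreservingAt_piece ho (Or.inl rfl) (p := D.equiv p) hp)
    (D.isLocalDiffeomorphAt_piece (Or.inl rfl) (p := D.equiv p) hp)

theorem orientationPreservingAt_equiv_toPerm [IsManifold I ∞ M]
    (ho : ∀ p ∈ D.U, p ∈ D.V → OrientationPreservingAt o o D.toPerm p) {p : M} (hp : p ∈ D.V) :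
    OrientationPreservingAt o (D.orientation ho) (fun q => D.equiv (D.toPerm q)) p := by
  let f : D.Space ≃ M := D.equiv.symm.trans D.toPerm.symm
  have hx : f (D.equiv (D.toPerm p)) = p := D.toPerm.symm_apply_apply p
  have hp' : D.equiv (D.toPerm p) ∈ D.pieceV.source := (D.mem_V_iff p).mpr hp
  have h := OrientationPreservingAt.equiv_symm (f := f) (x := D.equiv (D.toPerm p))
    (D.orientationPreservingAt_piece ho (Or.inr rfl) hp')
    (D.isLocalDiffeomorphAt_piece (Or.inr rfl) hp')
  rw [hx] at h
  exact h

end RegluingDatum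

/-! ### Supports of surface diffeomorphisms -/

namespace BoundedSurface

variable {S : BoundedSurface.{u}}

/-- An element of the diffeomorphism group as a diffeomorphism. -/
def toDiffeomorph (g : S.diffeoGroup) : S ≃ₘ^∞⟮𝓡∂ 2, 𝓡∂ 2⟯ S := ⟨g.1, g.2.1, g.2.2.1⟩

theorem isLocalDiffeomorphAt (g : S.diffeoGroup) (x : S) :
    IsLocalDiffeomorphAt (𝓡∂ 2) (𝓡∂ 2) ∞ g.1 x := (toDiffeomorph g).isLocalDiffeomorph x

theorem apply_mem_interior_iff (g : S.diffeoGroup) {x : S} :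
    g.1 x ∈ (𝓡∂ 2).interior S ↔ x ∈ (𝓡∂ 2).interior S :=
  ((isLocalDiffeomorphAt g x).isInteriorPoint_iff (by simp)).symm

/-- Supplies a compact neighbourhood, inside the interior of the surface, of the support of one
diffeomorphism or of a family that is the identity on a common neighbourhood of the boundary. -/
theorem exists_compact_core {A : Set S} (hA : A ∈ 𝓝ˢ ((𝓡∂ 2).boundary S)) :
    ∃ K : Set S, IsCompact K ∧ closure Aᶜ ⊆ interior K ∧ K ⊆ (𝓡∂ 2).interior S := by
  obtain ⟨B, hB, hbB, hBA⟩ := mem_nhdsSet_iff_exists.mp hA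
  have h1 : Bᶜ ⊆ (𝓡∂ 2).interior S := by
    rw [← ModelWithCorners.compl_boundary]
    exact compl_subset_compl.mpr hbB
  obtain ⟨K, hK, hBK, hKi⟩ := exists_compact_between hB.isClosed_compl.isCompact
    (ModelWithCorners.isOpen_interior (I := 𝓡∂ 2) (M := S) (n := ∞) (by simp)) h1
  exact ⟨K, hK, (closure_minimal (compl_subset_compl.mpr hBA) hB.isClosed_compl).trans hBK, hKi⟩

theorem apply_mem_iff_of_support_subset {g : S.diffeoGroup} {K : Set S}
    (h : {x | g.1 x ≠ x} ⊆ K) (x : S) : g.1 x ∈ K ↔ x ∈ K := by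
  by_cases hx : g.1 x = x
  · rw [hx]
  · exact ⟨fun _ => h hx, fun _ => h fun h' => hx (g.1.injective h')⟩

theorem closure_support_subset_interior (g : S.diffeoGroup) :
    closure {x | g.1 x ≠ x} ⊆ (𝓡∂ 2).interior S := by
  obtain ⟨K, -, h1, h2⟩ := exists_compact_core (A := {x | g.1 x = x}) g.2.2.2.2
  exact (h1.trans interior_subset).trans h2

end BoundedSurface

/-! ### Level-preserving permutations of a thickened surface -/

namespace EmbeddedSurface

variable {R : Type v} [TopologicalSpace R] [ChartedSpace (EuclideanSpace ℝ (Fin 2)) R]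
  {oR : ManifoldOrientation (𝓡 2) R} {M : ParamManifold.{u} oR} (E : EmbeddedSurface M)

theorem thick_injective : Function.Injective E.thick := E.thick_embedding.injective

theorem isOpen_thick_image {B : Set (E.S × ℝ)} (hB : IsOpen B)
    (h : ∀ q ∈ B, q.1 ∈ (𝓡∂ 2).interior E.S) : IsOpen (E.thick '' B) := by
  rw [isOpen_iff_mem_nhds]
  rintro _ ⟨q, hq, rfl⟩
  rw [← (E.thick_open q.1 (h q hq) q.2).map_nhds_eq]
  exact Filter.image_mem_map (hB.mem_nhds hq)

/-- The permutation of `S × ℝ` that acts by `P t` on the level `t`. -/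
def levelPerm {S : BoundedSurface.{u}} (P : ℝ → S.diffeoGroup) : Equiv.Perm (S × ℝ) where
  toFun q := ((P q.2).1 q.1, q.2)
  invFun q := ((P q.2).1.symm q.1, q.2)
  left_inv q := by simp
  right_inv q := by simp

/-- The permutation of `M` that acts by `P t` on the level `t` of the thickened surface, and
trivially outside the thickened surface. -/
def levelTwist (P : ℝ → E.S.diffeoGroup) : Equiv.Perm M :=
  (levelPerm P).viaEmbedding ⟨E.thick, E.thick_injective⟩

theorem levelTwist_thick (P : ℝ → E.S.diffeoGroup) (q : E.S × ℝ) :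
    E.levelTwist P (E.thick q) = E.thick ((P q.2).1 q.1, q.2) :=
  Equiv.Perm.viaEmbedding_apply (levelPerm P) ⟨E.thick, E.thick_injective⟩ q

theorem levelTwist_of_notMem (P : ℝ → E.S.diffeoGroup) {p : M} (hp : p ∉ range E.thick) :
    E.levelTwist P p = p :=
  Equiv.Perm.viaEmbedding_apply_of_notMem (levelPerm P) ⟨E.thick, E.thick_injective⟩ p hp

theorem levelTwist_mul (P Q : ℝ → E.S.diffeoGroup) (p : M) :
    E.levelTwist (fun t => P t * Q t) p = E.levelTwist P (E.levelTwist Q p) := by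
  by_cases hp : p ∈ range E.thick
  · obtain ⟨q, rfl⟩ := hp
    simp only [levelTwist_thick]
    rfl
  · rw [levelTwist_of_notMem _ _ hp, levelTwist_of_notMem _ _ hp, levelTwist_of_notMem _ _ hp]

section Local

variable {P : ℝ → E.S.diffeoGroup} {g : E.S.diffeoGroup} {x : E.S} {t : ℝ}

theorem isLocalDiffeomorphAt_thick_comp (hx : x ∈ (𝓡∂ 2).interior E.S) :
    IsLocalDiffeomorphAt ((𝓡∂ 2).prod 𝓘(ℝ, ℝ)) (𝓡∂ 3) ∞
      (fun q : E.S × ℝ => E.thick (Prod.map g.1 id q)) (x, t) :=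
  ((BoundedSurface.isLocalDiffeomorphAt g x).prodMap
    ((Diffeomorph.refl 𝓘(ℝ, ℝ) ℝ ∞).isLocalDiffeomorph t)).comp _ _
    (E.thick_open _ ((BoundedSurface.apply_mem_interior_iff g).mpr hx) t)

theorem levelTwist_comp_eventuallyEq
    (h : ∀ᶠ q : E.S × ℝ in 𝓝 (x, t), (P q.2).1 q.1 = g.1 q.1) :
    (fun q => E.levelTwist P (E.thick q)) =ᶠ[𝓝 (x, t)] fun q => E.thick (Prod.map g.1 id q) := by
  filter_upwards [h] with q hq
  rw [levelTwist_thick, hq]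
  rfl

/-- Near the point the permutation is `g × id` in the coordinates of `thick`. The hypothesis
compares actions rather than group elements: at a jump of `P`, points off the support of the jump
still see a locally constant action. -/
theorem isLocalDiffeomorphAt_levelTwist (hx : x ∈ (𝓡∂ 2).interior E.S)
    (h : ∀ᶠ q : E.S × ℝ in 𝓝 (x, t), (P q.2).1 q.1 = g.1 q.1) :
    IsLocalDiffeomorphAt (𝓡∂ 3) (𝓡∂ 3) ∞ (E.levelTwist P) (E.thick (x, t)) :=
  (E.thick_open x hx t).of_comp
    ((E.isLocalDiffeomorphAt_thick_comp hx).congr_of_eventuallyEq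
      (E.levelTwist_comp_eventuallyEq h))

/-- It suffices to test one frame. A positive frame of the surface followed by the normal vector is
sent, by `g × id`, to a frame of the same kind at `g x`, because `g` preserves the orientation of
the surface. -/
theorem orientationPreservingAt_levelTwist (hx : x ∈ (𝓡∂ 2).interior E.S)
    (h : ∀ᶠ q : E.S × ℝ in 𝓝 (x, t), (P q.2).1 q.1 = g.1 q.1) :
    OrientationPreservingAt M.orientation M.orientation (E.levelTwist P) (E.thick (x, t)) := by
  obtain ⟨v, hv⟩ := exists_isPositiveFrame
    (V := TangentSpace (𝓡∂ 2) x) (PiLp.basisFun 2 ℝ (Fin 2)) (E.S.orientation.atPoint x)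
  have hL := E.isLocalDiffeomorphAt_levelTwist hx h
  refine hL.orientationPreservingAt_of_exists (E.thick_orientation x t v hv) ?_
  have hgx := (BoundedSurface.apply_mem_interior_iff g).mpr hx
  have h1 := E.thick_orientation (g.1 x) t _ (g.2.2.2.1 x v hv)
  have hval : E.levelTwist P (E.thick (x, t)) = E.thick (g.1 x, t) := by
    have h0 := h.self_of_nhds
    rw [levelTwist_thick, h0]
  have hg : MDifferentiableAt (𝓡∂ 2) (𝓡∂ 2) g.1 x :=
    (BoundedSurface.isLocalDiffeomorphAt g x).contMDiffAt.mdifferentiableAt (by simp)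
  have e1 : (mfderiv ((𝓡∂ 2).prod 𝓘(ℝ, ℝ)) (𝓡∂ 3) (fun q => E.levelTwist P (E.thick q)) (x, t) :
      EuclideanSpace ℝ (Fin 2) × ℝ →L[ℝ] EuclideanSpace ℝ (Fin 3))
      = (mfderiv (𝓡∂ 3) (𝓡∂ 3) (E.levelTwist P) (E.thick (x, t))).comp
        (mfderiv ((𝓡∂ 2).prod 𝓘(ℝ, ℝ)) (𝓡∂ 3) E.thick (x, t)) :=
    mfderiv_comp (x, t) (hL.contMDiffAt.mdifferentiableAt (by simp))
      ((E.thick_open x hx t).contMDiffAt.mdifferentiableAt (by simp))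
  have e2 : (mfderiv ((𝓡∂ 2).prod 𝓘(ℝ, ℝ)) (𝓡∂ 3) (fun q => E.levelTwist P (E.thick q)) (x, t) :
      EuclideanSpace ℝ (Fin 2) × ℝ →L[ℝ] EuclideanSpace ℝ (Fin 3))
      = (mfderiv ((𝓡∂ 2).prod 𝓘(ℝ, ℝ)) (𝓡∂ 3) E.thick (g.1 x, t)).comp
        (mfderiv ((𝓡∂ 2).prod 𝓘(ℝ, ℝ)) ((𝓡∂ 2).prod 𝓘(ℝ, ℝ))
          (Prod.map g.1 (id : ℝ → ℝ)) (x, t)) :=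
    ((E.levelTwist_comp_eventuallyEq h).mfderiv_eq).trans
      (mfderiv_comp (x, t) ((E.thick_open _ hgx t).contMDiffAt.mdifferentiableAt (by simp))
        (hg.prodMap mdifferentiableAt_id))
  have e3 : mfderiv ((𝓡∂ 2).prod 𝓘(ℝ, ℝ)) ((𝓡∂ 2).prod 𝓘(ℝ, ℝ))
          (Prod.map g.1 (id : ℝ → ℝ)) (x, t)
      = (mfderiv (𝓡∂ 2) (𝓡∂ 2) g.1 x).prodMap (mfderiv 𝓘(ℝ, ℝ) 𝓘(ℝ, ℝ) (id : ℝ → ℝ) t) :=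
    mfderiv_prodMap hg mdifferentiableAt_id
  have key : ∀ (a : EuclideanSpace ℝ (Fin 2)) (b : ℝ),
      (mfderiv (𝓡∂ 3) (𝓡∂ 3) (E.levelTwist P) (E.thick (x, t))
        (mfderiv ((𝓡∂ 2).prod 𝓘(ℝ, ℝ)) (𝓡∂ 3) E.thick (x, t) (a, b)) : EuclideanSpace ℝ (Fin 3))
      = mfderiv ((𝓡∂ 2).prod 𝓘(ℝ, ℝ)) (𝓡∂ 3) E.thick (g.1 x, t)
          (mfderiv (𝓡∂ 2) (𝓡∂ 2) g.1 x a, b) := by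
    intro a b
    have h3 := e1.symm.trans e2
    rw [e3, mfderiv_id] at h3
    exact congrArg (fun T : EuclideanSpace ℝ (Fin 2) × ℝ →L[ℝ] EuclideanSpace ℝ (Fin 3) =>
      T (a, b)) h3
  rw [hval]
  convert h1 using 1
  funext i
  fin_cases i
  · exact key (v 0) 0
  · exact key (v 1) 0
  · have h0 : (mfderiv (𝓡∂ 2) (𝓡∂ 2) g.1 x (0 : TangentSpace (𝓡∂ 2) x)) = 0 := map_zero _
    exact (key 0 1).trans (congrArg (fun a : EuclideanSpace ℝ (Fin 2) =>
      (mfderiv ((𝓡∂ 2).prod 𝓘(ℝ, ℝ)) (𝓡∂ 3) E.thick (g.1 x, t) (a, (1 : ℝ)) :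
        EuclideanSpace ℝ (Fin 3))) h0)

end Local

end EmbeddedSurface

/-! ### Regluing along a surface by an arbitrary diffeomorphism -/

namespace EmbeddedSurface

variable {R : Type v} [TopologicalSpace R] [ChartedSpace (EuclideanSpace ℝ (Fin 2)) R]
  {oR : ManifoldOrientation (𝓡 2) R} {M : ParamManifold.{u} oR} (E : EmbeddedSurface M)

/-- The step function with value `1` for `t ≤ 0` and `f` for `t > 0`. -/
def step {S : BoundedSurface.{u}} (f : S.diffeoGroup) (t : ℝ) : S.diffeoGroup :=
  if t ≤ 0 then 1 else f

/-- Off height zero the step is locally constant; at height zero, off the support, both of its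
values act as the identity. -/
theorem step_eventually {S : BoundedSurface.{u}} (f : S.diffeoGroup) {x : S} {t : ℝ}
    (h : t ≠ 0 ∨ x ∉ closure {y | f.1 y ≠ y}) :
    ∀ᶠ q : S × ℝ in 𝓝 (x, t), (step f q.2).1 q.1 = (step f t).1 q.1 := by
  have hc : Filter.Tendsto (Prod.snd : S × ℝ → ℝ) (𝓝 (x, t)) (𝓝 t) := continuous_snd.continuousAt
  rcases lt_trichotomy t 0 with ht | rfl | ht
  · filter_upwards [hc.eventually (eventually_lt_nhds ht)] with q hq
    rw [step, step, if_pos hq.le, if_pos ht.le]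
  · have hx : x ∉ closure {y | f.1 y ≠ y} := h.resolve_left (by simp)
    have hc' : Filter.Tendsto (Prod.fst : S × ℝ → S) (𝓝 (x, 0)) (𝓝 x) :=
      continuous_fst.continuousAt
    filter_upwards [hc'.eventually (isClosed_closure.isOpen_compl.mem_nhds hx)] with q hq
    have hq' : f.1 q.1 = q.1 := by
      by_contra h'
      exact hq (subset_closure h')
    rw [step, step, if_pos le_rfl]
    split_ifs
    · rfl
    · exact hq'
  · filter_upwards [hc.eventually (eventually_gt_nhds ht)] with q hq
    rw [step, step, if_neg (not_le.mpr hq), if_neg (not_le.mpr ht)]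

theorem step_apply_ne_subset {S : BoundedSurface.{u}} (f : S.diffeoGroup) (t : ℝ) :
    {x | (step f t).1 x ≠ x} ⊆ {x | f.1 x ≠ x} := by
  intro x hx
  simp only [step, mem_ofPred_eq] at hx
  split_ifs at hx
  · exact absurd rfl hx
  · exact hx

/-- The regluing of `M` along the surface by the diffeomorphism `f`, where `K` is a compact
neighbourhood of the support of `f` in the interior of the surface. -/
def regluing (f : E.S.diffeoGroup) (K : Set E.S) (hK : IsCompact K)
    (hfK : closure {x | f.1 x ≠ x} ⊆ interior K) (hKi : K ⊆ (𝓡∂ 2).interior E.S) :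
    RegluingDatum (𝓡∂ 3) M where
  toPerm := E.levelTwist (step f)
  -- Only the support at height zero is removed, so `U` contains the edge of the thickened surface.
  -- There `thick` is not known to be open, and `V` omits it.
  U := (E.thick '' (closure {x | f.1 x ≠ x} ×ˢ {0}))ᶜ
  V := E.thick '' ((𝓡∂ 2).interior E.S ×ˢ univ)
  K := E.thick '' (K ×ˢ Icc (-1) 1)
  isOpen_U := ((isClosed_closure.isCompact.prod isCompact_singleton).image
    E.thick_smooth.continuous).isClosed.isOpen_compl
  isOpen_V := E.isOpen_thick_image
    ((ModelWithCorners.isOpen_interior (n := ∞) (by simp)).prod isOpen_univ) fun _ h => h.1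
  mem_or_mem := by
    intro p
    by_cases hp : p ∈ E.thick '' (closure {x | f.1 x ≠ x} ×ˢ {0})
    · right
      obtain ⟨q, hq, rfl⟩ := hp
      exact mem_image_of_mem _ ⟨BoundedSurface.closure_support_subset_interior f hq.1, trivial⟩
    · exact Or.inl hp
  mem_V_iff := by
    intro p
    by_cases hp : p ∈ range E.thick
    · obtain ⟨q, rfl⟩ := hp
      rw [levelTwist_thick, E.thick_injective.mem_set_image, E.thick_injective.mem_set_image]
      simp only [mem_prod, mem_univ, and_true]
      exact BoundedSurface.apply_mem_interior_iff _
    · rw [levelTwist_of_notMem _ _ hp]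
  mem_U_iff := by
    rintro _ ⟨q, -, rfl⟩
    rw [levelTwist_thick, mem_compl_iff, mem_compl_iff, E.thick_injective.mem_set_image,
      E.thick_injective.mem_set_image]
    simp only [mem_prod, mem_singleton_iff]
    by_cases h : q.2 = 0
    · have h1 : step f q.2 = 1 := if_pos h.le
      rw [h1]
      rfl
    · simp [h]
  isLocalDiffeomorphAt := by
    rintro _ hU ⟨⟨x, t⟩, hq, rfl⟩
    rw [mem_compl_iff, E.thick_injective.mem_set_image] at hU
    refine E.isLocalDiffeomorphAt_levelTwist (g := step f t) hq.1 (step_eventually f ?_)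
    by_contra! h
    exact hU ⟨h.2, h.1⟩
  isCompact_K := (hK.prod isCompact_Icc).image E.thick_smooth.continuous
  isClosed_K := ((hK.prod isCompact_Icc).image E.thick_smooth.continuous).isClosed
  K_subset := image_mono (prod_mono hKi (subset_univ _))
  compl_U_subset := by
    rw [compl_compl]
    have h1 : IsOpen (E.thick '' (interior K ×ˢ Ioo (-1) 1)) :=
      E.isOpen_thick_image (isOpen_interior.prod isOpen_Ioo) fun q hq => hKi (interior_subset hq.1)
    refine Subset.trans (image_mono (prod_mono hfK ?_)) (interior_maximal
      (image_mono (prod_mono interior_subset Ioo_subset_Icc_self)) h1)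
    rw [singleton_subset_iff]
    norm_num
  mem_K_iff := by
    intro p
    by_cases hp : p ∈ range E.thick
    · obtain ⟨q, rfl⟩ := hp
      rw [levelTwist_thick, E.thick_injective.mem_set_image, E.thick_injective.mem_set_image]
      simp only [mem_prod]
      rw [BoundedSurface.apply_mem_iff_of_support_subset]
      exact (step_apply_ne_subset f q.2).trans
        (subset_closure.trans (hfK.trans interior_subset))
    · rw [levelTwist_of_notMem _ _ hp]

/-- The bijection `h` exhibits `N` as obtained by regluing `M` along the surface `E` by the
diffeomorphism `f`, compatibly with the orientations and on the whole thickened surface. -/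
structure IsRegluing (f : E.S.diffeoGroup) (N : ParamManifold.{u} oR) (h : M ≃ N) : Prop where
  param : ∀ r, h (M.param r) = N.param r
  off_support : ∀ p : M, (∀ x ∈ closure {x | f.1 x ≠ x}, p ≠ E.thick (x, 0)) →
    IsLocalDiffeomorphAt (𝓡∂ 3) (𝓡∂ 3) ∞ h p ∧
    OrientationPreservingAt M.orientation N.orientation h p
  across : ∀ x ∈ (𝓡∂ 2).interior E.S, ∀ t : ℝ,
    IsLocalDiffeomorphAt (𝓡∂ 3) (𝓡∂ 3) ∞ (fun p => h (E.levelTwist (step f) p))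
      (E.thick (x, t)) ∧
    OrientationPreservingAt M.orientation N.orientation
      (fun p => h (E.levelTwist (step f) p)) (E.thick (x, t))

/-- A manifold can be cut along an embedded surface and glued back by any diffeomorphism of the
surface. -/
theorem exists_isRegluing (f : E.S.diffeoGroup) :
    ∃ (N : ParamManifold.{u} oR) (h : M ≃ N), E.IsRegluing f N h := by
  obtain ⟨K, hK, hfK, hKi⟩ := BoundedSurface.exists_compact_core (A := {x | f.1 x = x}) f.2.2.2.2
  let D := E.regluing f K hK hfK hKi
  have hmemU : ∀ p : M, (∀ x ∈ closure {x | f.1 x ≠ x}, p ≠ E.thick (x, 0)) → p ∈ D.U := by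
    rintro p hp ⟨⟨x, t⟩, ⟨hx, rfl⟩, rfl⟩
    exact hp x hx rfl
  have hmemU' : ∀ p : M, p ∉ range E.thick → p ∈ D.U := fun p hp =>
    hmemU p fun x _ h => hp ⟨_, h.symm⟩
  have hmemV : ∀ x ∈ (𝓡∂ 2).interior E.S, ∀ t : ℝ, E.thick (x, t) ∈ D.V := fun x hx t =>
    mem_image_of_mem _ ⟨hx, trivial⟩
  have ho : ∀ p ∈ D.U, p ∈ D.V →
      OrientationPreservingAt M.orientation M.orientation D.toPerm p := by
    rintro _ hU ⟨⟨x, t⟩, hq, rfl⟩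
    refine E.orientationPreservingAt_levelTwist (g := step f t) hq.1 (step_eventually f ?_)
    by_contra! h
    exact hU (mem_image_of_mem _ ⟨h.2, h.1⟩)
  -- The connected set is the image of all of `S × ℝ`, edge included: connectedness of `S` is given,
  -- whereas that of its interior would need proof. Continuity at the edge holds because `f` is the
  -- identity nearby.
  have hconn : ConnectedSpace D.Space := by
    have hcont : Continuous fun q : E.S × ℝ => D.equiv (E.levelTwist (step f) (E.thick q)) := by
      rw [continuous_iff_continuousAt]
      rintro ⟨x, t⟩
      by_cases hx : x ∈ (𝓡∂ 2).interior E.S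
      · have h1 : ContinuousAt (fun q => D.equiv (E.levelTwist (step f) q)) (E.thick (x, t)) :=
          (D.isLocalDiffeomorphAt_equiv_toPerm (hmemV x hx t)).contMDiffAt.continuousAt
        exact ContinuousAt.comp (f := E.thick) h1 E.thick_smooth.continuous.continuousAt
      · have hx' : x ∉ closure {y | f.1 y ≠ y} := fun h =>
          hx (BoundedSurface.closure_support_subset_interior f h)
        have hU : E.thick (x, t) ∈ D.U := hmemU _ fun y hy h => by
          have := E.thick_injective h
          simp only [Prod.mk.injEq] at this
          exact hx' (this.1 ▸ hy)
        have h1 : ContinuousAt D.equiv (E.thick (x, t)) :=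
          (D.isLocalDiffeomorphAt_equiv hU).contMDiffAt.continuousAt
        have h2 : ContinuousAt (fun q => D.equiv (E.thick q)) (x, t) :=
          ContinuousAt.comp (f := E.thick) h1 E.thick_smooth.continuous.continuousAt
        refine h2.congr ?_
        have hc' : Filter.Tendsto (Prod.fst : E.S × ℝ → E.S) (𝓝 (x, t)) (𝓝 x) :=
          continuous_fst.continuousAt
        filter_upwards [hc'.eventually (isClosed_closure.isOpen_compl.mem_nhds hx')] with q hq
        rw [levelTwist_thick]
        congr 2
        ext1
        · by_contra h'
          exact hq (subset_closure (step_apply_ne_subset f q.2 (Ne.symm h')))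
        · rfl
    refine D.connectedSpace (isPreconnected_range hcont) ?_
    rintro _ ⟨p, hp, rfl⟩
    obtain ⟨q, -, hq⟩ : D.toPerm.symm p ∈ D.V := (D.symm_mem_V_iff p).mpr hp
    refine ⟨q, ?_⟩
    change D.equiv (E.levelTwist (step f) (E.thick q)) = _
    rw [hq]
    exact congrArg _ (D.toPerm.apply_symm_apply p)
  have hparam : ∀ r, M.param r ∈ D.U := by
    intro r
    apply hmemU'
    intro h
    have h1 : M.param r ∈ (𝓡∂ 3).boundary M := M.param_range ▸ mem_range_self r
    exact (ModelWithCorners.disjoint_interior_boundary (I := 𝓡∂ 3) (M := M)).le_bot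
      ⟨E.thick_interior h, h1⟩
  have hpm : ∀ r, MDifferentiableAt (𝓡 2) (𝓡∂ 3) M.param r := fun r =>
    (M.param_smooth r).mdifferentiableAt (by simp)
  have hrange : range (fun r => D.equiv (M.param r)) = (𝓡∂ 3).boundary D.Space := by
    have hVi : D.V ⊆ (𝓡∂ 3).interior M := (image_subset_range _ _).trans E.thick_interior
    rw [range_comp' D.equiv M.param, M.param_range]
    ext p
    obtain ⟨x, rfl⟩ := D.equiv.surjective p
    rw [D.equiv.injective.mem_set_image]
    by_cases hx : x ∈ D.U
    · exact (D.isLocalDiffeomorphAt_equiv hx).isBoundaryPoint_iff (by simp)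
    -- A point outside `U` lies in `V`, hence is interior in `M`; the gluing map on `V` shows that
    -- it is interior in the reglued manifold too.
    · have hxV : x ∈ D.V := (D.mem_or_mem x).resolve_left hx
      have hyV := (D.symm_mem_V_iff x).mpr hxV
      have h1 := (D.isLocalDiffeomorphAt_equiv_toPerm hyV).isInteriorPoint_iff (by simp)
      rw [Equiv.apply_symm_apply] at h1
      have h2 : (𝓡∂ 3).IsInteriorPoint x := hVi hxV
      have h3 := h1.mp (hVi hyV)
      rw [ModelWithCorners.isInteriorPoint_iff_not_isBoundaryPoint] at h2 h3
      exact iff_of_false h2 h3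
  let N : ParamManifold.{u} oR :=
    { carrier := D.Space
      orientation := D.orientation ho
      param := fun r => D.equiv (M.param r)
      param_smooth := fun r =>
        ContMDiffAt.comp r (D.isLocalDiffeomorphAt_equiv (hparam r)).contMDiffAt (M.param_smooth r)
      param_injective := D.equiv.injective.comp M.param_injective
      param_range := hrange
      param_orientation := by
        intro r v hv n hn
        have h1 : IsPositiveFrame (V := EuclideanSpace ℝ (Fin 3)) _ _ :=
          M.param_orientation r v hv n hn
        have h2 : D.piece (D.equiv (M.param r)) (D.equiv (M.param r)) = M.param r := by
          have h : D.piece (D.equiv (M.param r)) = D.pieceU := D.piece_eq_pieceU (hparam r)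
          rw [h]
          rfl
        have h3 : (mfderiv (𝓡 2) (𝓡∂ 3) (fun r => D.equiv (M.param r)) r :
            EuclideanSpace ℝ (Fin 2) →L[ℝ] EuclideanSpace ℝ (Fin 3))
            = mfderiv (𝓡 2) (𝓡∂ 3) M.param r :=
          ((D.hasMFDerivAt_equiv (hparam r)).comp r (hpm r).hasMFDerivAt).mfderiv.trans
            (ContinuousLinearMap.id_comp _)
        change IsPositiveFrame (V := EuclideanSpace ℝ (Fin 3))
          (M.orientation.atPoint (D.piece (D.equiv (M.param r)) (D.equiv (M.param r))))
          ![n, (mfderiv (𝓡 2) (𝓡∂ 3) (fun r => D.equiv (M.param r)) r :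
            EuclideanSpace ℝ (Fin 2) →L[ℝ] EuclideanSpace ℝ (Fin 3)) (v 0),
            (mfderiv (𝓡 2) (𝓡∂ 3) (fun r => D.equiv (M.param r)) r :
            EuclideanSpace ℝ (Fin 2) →L[ℝ] EuclideanSpace ℝ (Fin 3)) (v 1)]
        rw [h2, h3]
        exact h1 }
  refine ⟨N, D.equiv, fun r => rfl, fun p hp => ⟨?_, ?_⟩, fun x hx t => ⟨?_, ?_⟩⟩
  · exact D.isLocalDiffeomorphAt_equiv (hmemU p hp)
  · exact D.orientationPreservingAt_equiv ho (hmemU p hp)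
  · exact D.isLocalDiffeomorphAt_equiv_toPerm (hmemV x hx t)
  · exact D.orientationPreservingAt_equiv_toPerm ho (hmemV x hx t)

end EmbeddedSurface

/-! ### Parallel copies, and spreading a regluing over several levels -/

namespace EmbeddedSurface

variable {R : Type v} [TopologicalSpace R] [ChartedSpace (EuclideanSpace ℝ (Fin 2)) R]
  {oR : ManifoldOrientation (𝓡 2) R} {M : ParamManifold.{u} oR} (E : EmbeddedSurface M)

/-- Translations of the line as diffeomorphisms. -/
def translation (c : ℝ) : ℝ ≃ₘ^∞⟮𝓘(ℝ, ℝ), 𝓘(ℝ, ℝ)⟯ ℝ where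
  toEquiv := Equiv.addRight c
  contMDiff_toFun := (contDiff_id.add contDiff_const).contMDiff
  contMDiff_invFun := (contDiff_id.add contDiff_const).contMDiff

/-- The parallel copy of the surface at height `c`. -/
def shift (c : ℝ) : EmbeddedSurface M where
  S := E.S
  thick q := E.thick (Prod.map id (translation c) q)
  thick_smooth := E.thick_smooth.comp (contMDiff_id.prodMap (translation c).contMDiff)
  thick_embedding := E.thick_embedding.comp
    ((Homeomorph.refl E.S).prodCongr (translation c).toHomeomorph).isEmbedding
  thick_interior := (range_comp_subset_range _ _).trans E.thick_interior
  thick_open x hx t := (((Diffeomorph.refl (𝓡∂ 2) E.S ∞).isLocalDiffeomorph x).prodMap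
    ((translation c).isLocalDiffeomorph t)).comp _ _ (E.thick_open x hx _)
  thick_orientation x t v hv := by
    have h1 := E.thick_orientation x (translation c t) v hv
    have e1 : (mfderiv ((𝓡∂ 2).prod 𝓘(ℝ, ℝ)) (𝓡∂ 3)
        (fun q : E.S × ℝ => E.thick (Prod.map id (translation c) q)) (x, t) :
        EuclideanSpace ℝ (Fin 2) × ℝ →L[ℝ] EuclideanSpace ℝ (Fin 3))
        = (mfderiv ((𝓡∂ 2).prod 𝓘(ℝ, ℝ)) (𝓡∂ 3) E.thick (x, translation c t)).comp
          (mfderiv ((𝓡∂ 2).prod 𝓘(ℝ, ℝ)) ((𝓡∂ 2).prod 𝓘(ℝ, ℝ))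
            (Prod.map (id : E.S → E.S) (translation c)) (x, t)) :=
      mfderiv_comp (x, t) ((E.thick_smooth _).mdifferentiableAt (by simp))
        (mdifferentiableAt_id.prodMap (((translation c).contMDiff t).mdifferentiableAt (by simp)))
    have e2 : mfderiv ((𝓡∂ 2).prod 𝓘(ℝ, ℝ)) ((𝓡∂ 2).prod 𝓘(ℝ, ℝ))
          (Prod.map (id : E.S → E.S) (translation c)) (x, t)
        = (mfderiv (𝓡∂ 2) (𝓡∂ 2) (id : E.S → E.S) x).prodMap
          (mfderiv 𝓘(ℝ, ℝ) 𝓘(ℝ, ℝ) (translation c) t) :=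
      mfderiv_prodMap mdifferentiableAt_id
        (((translation c).contMDiff t).mdifferentiableAt (by simp))
    have e3 : mfderiv 𝓘(ℝ, ℝ) 𝓘(ℝ, ℝ) (translation c) t = ContinuousLinearMap.id ℝ ℝ :=
      ((hasFDerivAt_id t).add_const c).hasMFDerivAt.mfderiv
    have e4 : (mfderiv ((𝓡∂ 2).prod 𝓘(ℝ, ℝ)) (𝓡∂ 3)
        (fun q : E.S × ℝ => E.thick (Prod.map id (translation c) q)) (x, t) :
        EuclideanSpace ℝ (Fin 2) × ℝ →L[ℝ] EuclideanSpace ℝ (Fin 3))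
        = mfderiv ((𝓡∂ 2).prod 𝓘(ℝ, ℝ)) (𝓡∂ 3) E.thick (x, translation c t) := by
      rw [e1, e2, mfderiv_id, e3]
      rfl
    change IsPositiveFrame (V := EuclideanSpace ℝ (Fin 3)) _
      ![(mfderiv ((𝓡∂ 2).prod 𝓘(ℝ, ℝ)) (𝓡∂ 3)
        (fun q : E.S × ℝ => E.thick (Prod.map id (translation c) q)) (x, t) :
        EuclideanSpace ℝ (Fin 2) × ℝ →L[ℝ] EuclideanSpace ℝ (Fin 3)) (v 0, 0),
        (mfderiv ((𝓡∂ 2).prod 𝓘(ℝ, ℝ)) (𝓡∂ 3)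
        (fun q : E.S × ℝ => E.thick (Prod.map id (translation c) q)) (x, t) :
        EuclideanSpace ℝ (Fin 2) × ℝ →L[ℝ] EuclideanSpace ℝ (Fin 3)) (v 1, 0),
        (mfderiv ((𝓡∂ 2).prod 𝓘(ℝ, ℝ)) (𝓡∂ 3)
        (fun q : E.S × ℝ => E.thick (Prod.map id (translation c) q)) (x, t) :
        EuclideanSpace ℝ (Fin 2) × ℝ →L[ℝ] EuclideanSpace ℝ (Fin 3)) (0, 1)]
    rw [e4]
    exact h1

theorem shift_thick (c : ℝ) (x : E.S) (t : ℝ) : (E.shift c).thick (x, t) = E.thick (x, t + c) := rfl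

theorem disjoint_shift_image {c c' : ℝ} (h : c ≠ c') :
    Disjoint (E.shift c).image (E.shift c').image := by
  rw [Set.disjoint_left]
  rintro _ ⟨x, rfl⟩ ⟨y, hy⟩
  have h1 := E.thick_injective hy
  simp only [Prod.map, Prod.mk.injEq] at h1
  have h2 : (0 : ℝ) + c' = 0 + c := h1.2
  exact h (by linarith)

/-- The function `P` is a step function on the line, with value `j t * P t` just above `t`; it is
`1` far below, `f` far above, and all its values are trivial near the boundary. -/
structure IsStepFunction {S : BoundedSurface.{u}} (P j : ℝ → S.diffeoGroup) (f : S.diffeoGroup)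
    (c : ℝ) : Prop where
  jump : ∀ t₀, ∀ᶠ t in 𝓝 t₀, P t = if t ≤ t₀ then P t₀ else j t₀ * P t₀
  pos : 0 < c
  below : ∀ t, t ≤ -c → P t = 1
  above : ∀ t, c ≤ t → P t = f
  near_boundary : ∀ᶠ x in 𝓝ˢ ((𝓡∂ 2).boundary S), ∀ t, (P t).1 x = x

section StepFunction

variable {E} {P j : ℝ → E.S.diffeoGroup} {f : E.S.diffeoGroup} {c : ℝ}
  {N : ParamManifold.{u} oR} {h : M ≃ N}

/-- The bijection that spreads the regluing over the levels where the step function jumps. -/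
def spread (P : ℝ → E.S.diffeoGroup) (f : E.S.diffeoGroup) (h : M ≃ N) : M ≃ N :=
  (E.levelTwist fun t => step f t * (P t)⁻¹).trans h

/-- In this factorization the outer map `h ∘ levelTwist (step f)` is smooth across the thickened
interior, so all discontinuity of `spread` comes from the jumps of `P`. -/
theorem spread_eq (p : M) : spread P f h p
    = h (E.levelTwist (step f) (E.levelTwist (fun t => (P t)⁻¹) p)) :=
  congrArg h (E.levelTwist_mul _ _ p)

theorem spread_of_notMem {p : M} (hp : p ∉ range E.thick) : spread P f h p = h p :=
  congrArg h (E.levelTwist_of_notMem _ hp)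

theorem spread_thick (x : E.S) (t : ℝ) : spread P f h (E.thick (x, t))
    = h (E.levelTwist (step f) (E.thick ((P t).1.symm x, t))) := by
  rw [spread_eq, levelTwist_thick]
  rfl

/-- Over the interior of the surface, a jump acting trivially near `x` leaves the action of `P⁻¹`
locally constant. At the edge or outside the thickened surface, `spread` coincides with `h` near
`p`. -/
theorem IsStepFunction.off_support (hP : IsStepFunction P j f c) (hh : E.IsRegluing f N h) {p : M}
    (hp : ∀ x t, p = E.thick (x, t) → x ∉ closure {x | (j t).1 x ≠ x}) :
    IsLocalDiffeomorphAt (𝓡∂ 3) (𝓡∂ 3) ∞ (spread P f h) p ∧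
    OrientationPreservingAt M.orientation N.orientation (spread P f h) p := by
  by_cases hpi : ∃ x ∈ (𝓡∂ 2).interior E.S, ∃ t, p = E.thick (x, t)
  · obtain ⟨x, hx, t, rfl⟩ := hpi
    have hxj := hp x t rfl
    have hev : ∀ᶠ q : E.S × ℝ in 𝓝 (x, t), ((P q.2)⁻¹).1 q.1 = ((P t)⁻¹).1 q.1 := by
      have hc : Filter.Tendsto (Prod.snd : E.S × ℝ → ℝ) (𝓝 (x, t)) (𝓝 t) :=
        continuous_snd.continuousAt
      have hc' : Filter.Tendsto (Prod.fst : E.S × ℝ → E.S) (𝓝 (x, t)) (𝓝 x) :=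
        continuous_fst.continuousAt
      filter_upwards [hc.eventually (hP.jump t),
        hc'.eventually (isClosed_closure.isOpen_compl.mem_nhds hxj)] with q hq hqj
      have hj : (j t).1 q.1 = q.1 := by
        by_contra h'
        exact hqj (subset_closure h')
      rw [hq]
      split_ifs
      · rfl
      · rw [mul_inv_rev]
        exact congrArg ((P t)⁻¹).1 (Equiv.Perm.eq_inv_iff_eq.mpr hj).symm
    have h1 := E.isLocalDiffeomorphAt_levelTwist (P := fun t => (P t)⁻¹) hx hev
    have h2 := E.orientationPreservingAt_levelTwist (P := fun t => (P t)⁻¹) hx hev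
    have h3 := hh.across (((P t)⁻¹).1 x) ((BoundedSurface.apply_mem_interior_iff _).mpr hx) t
    have h4 : E.levelTwist (fun t => (P t)⁻¹) (E.thick (x, t)) = E.thick (((P t)⁻¹).1 x, t) :=
      E.levelTwist_thick _ _
    rw [← h4] at h3
    have e : ⇑(spread P f h)
        = fun p => h (E.levelTwist (step f) (E.levelTwist (fun t => (P t)⁻¹) p)) :=
      funext spread_eq
    rw [e]
    exact ⟨h1.comp _ _ h3.1, OrientationPreservingAt.comp_of_mdifferentiableAt
      (g := fun p => h (E.levelTwist (step f) p)) (f := E.levelTwist fun t => (P t)⁻¹)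
      (h3.1.contMDiffAt.mdifferentiableAt (by simp))
      (h1.contMDiffAt.mdifferentiableAt (by simp)) h3.2 h2⟩
  · obtain ⟨K, hK, hAK, hKi⟩ := BoundedSurface.exists_compact_core hP.near_boundary
    have hfix : ∀ x ∉ K, ∀ t, (P t).1 x = x := fun x hx => by
      by_contra h'
      exact hx (interior_subset (hAK (subset_closure h')))
    have hf : ∀ x, (∀ t, (P t).1 x = x) → f.1 x = x := fun x hx => by
      rw [← hP.above c le_rfl]
      exact hx c
    -- Off this compact set `spread` equals `h`: either `f` and all values of `P` fix the point, or
    -- the height is beyond `±c`, where `P` and `step f` agree.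
    let L := E.thick '' (K ×ˢ Icc (-c) c)
    have hL : IsClosed L :=
      ((hK.prod isCompact_Icc).image E.thick_smooth.continuous).isClosed
    have hpL : p ∉ L := by
      rintro ⟨⟨x, t⟩, hq, rfl⟩
      exact hpi ⟨x, hKi hq.1, t, rfl⟩
    have hev : ⇑(spread P f h) =ᶠ[𝓝 p] h := by
      filter_upwards [hL.isOpen_compl.mem_nhds hpL] with q hq
      by_cases hqr : q ∈ range E.thick
      · obtain ⟨⟨x, t⟩, rfl⟩ := hqr
        rw [mem_compl_iff, E.thick_injective.mem_set_image] at hq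
        refine congrArg h ?_
        rw [levelTwist_thick]
        have hx : (step f t * (P t)⁻¹).1 x = x := by
          by_cases hxK : x ∈ K
          · have ht : ¬ (-c ≤ t ∧ t ≤ c) := fun h' => hq ⟨hxK, h'⟩
            have hc := hP.pos
            rcases lt_or_ge t (-c) with h' | h'
            · rw [hP.below t h'.le, step, if_pos (by linarith)]
              rfl
            · have h'' : c < t := lt_of_not_ge fun h3 => ht ⟨h', h3⟩
              rw [hP.above t h''.le, step, if_neg (by linarith), mul_inv_cancel]
              rfl
          · have h1 : ((P t)⁻¹).1 x = x := (Equiv.Perm.eq_inv_iff_eq.mpr (hfix x hxK t)).symm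
            have h2 : (step f t).1 x = x := by
              by_contra h'
              exact step_apply_ne_subset f t h' (hf x (hfix x hxK))
            exact (congrArg (step f t).1 h1).trans h2
        rw [hx]
      · exact spread_of_notMem hqr
    have h1 := hh.off_support p fun x hx hpx => hpi ⟨x,
      BoundedSurface.closure_support_subset_interior f hx, 0, hpx⟩
    exact ⟨h1.1.congr_of_eventuallyEq hev, h1.2.congr_of_eventuallyEq hev⟩

/-- Just above height `t` the inverse of `P` is `(j t * P t)⁻¹`, and precomposing with `j t` leaves
`(P t)⁻¹`. The two branches thus merge into one smooth map. -/
theorem IsStepFunction.across (hP : IsStepFunction P j f c) (hh : E.IsRegluing f N h) {x : E.S}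
    (hx : x ∈ (𝓡∂ 2).interior E.S) (t : ℝ) :
    IsLocalDiffeomorphAt ((𝓡∂ 2).prod 𝓘(ℝ, ℝ)) (𝓡∂ 3) ∞
      (fun q : E.S × ℝ => if q.2 ≤ 0 then spread P f h (E.thick (q.1, q.2 + t))
        else spread P f h (E.thick ((j t).1 q.1, q.2 + t))) (x, 0) := by
  have hx' := (BoundedSurface.apply_mem_interior_iff (P t)⁻¹).mpr hx
  have h1 := ((BoundedSurface.isLocalDiffeomorphAt (P t)⁻¹ x).prodMap
    ((translation t).isLocalDiffeomorph 0)).comp _ _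
    ((E.thick_open _ hx' _).comp _ _ (hh.across _ hx' _).1)
  refine h1.congr_of_eventuallyEq ?_
  have hc : Filter.Tendsto (fun q : E.S × ℝ => q.2 + t) (𝓝 (x, 0)) (𝓝 t) := by
    have h : ContinuousAt (fun q : E.S × ℝ => q.2 + t) (x, 0) := by fun_prop
    rw [ContinuousAt, zero_add] at h
    exact h
  filter_upwards [hc.eventually (hP.jump t)] with q hq
  have hval : ∀ y, spread P f h (E.thick (y, q.2 + t))
      = h (E.levelTwist (step f) (E.thick ((P (q.2 + t)).1.symm y, q.2 + t))) :=
    fun y => spread_thick y _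
  rw [hval, hval, hq]
  by_cases h0 : q.2 ≤ 0
  · rw [if_pos h0, if_pos (by linarith)]
    rfl
  · rw [if_neg h0, if_neg (by linarith)]
    have e : (j t * P t).1.symm ((j t).1 q.1) = (P t).1.symm q.1 :=
      congrArg (P t).1.symm ((j t).1.symm_apply_apply q.1)
    rw [e]
    rfl

end StepFunction

end EmbeddedSurface

/-! ### Ordered products and the step function on integer levels -/

/-- The ordered product of `F k` over `m ≤ k < n`. -/
def tailProd {G : Type*} [Group G] (F : ℕ → G) (n m : ℕ) : G :=
  ((List.range' m (n - m)).map F).prod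

theorem tailProd_of_le {G : Type*} [Group G] (F : ℕ → G) {n m : ℕ} (h : n ≤ m) :
    tailProd F n m = 1 := by
  simp [tailProd, Nat.sub_eq_zero_of_le h]

/-- Extending `F` by `1` beyond `n` makes the recursion valid for every `m`, so jump levels need no
upper bound. -/
theorem tailProd_eq_mul {G : Type*} [Group G] {F : ℕ → G} {n : ℕ} (hF : ∀ k, n ≤ k → F k = 1)
    (m : ℕ) : tailProd F n m = F m * tailProd F n (m + 1) := by
  rcases le_or_gt n m with h | h
  · rw [tailProd_of_le F h, tailProd_of_le F (by lia), hF m h, one_mul]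
  · have e : n - m = (n - (m + 1)) + 1 := by lia
    rw [tailProd, e, List.range'_succ, List.map_cons, List.prod_cons]
    rfl

namespace EmbeddedSurface

section Levels

variable {S : BoundedSurface.{u}}

/-- The step function jumping by `F k` at the level `-k`, for `k < n`. -/
def levels (F : ℕ → S.diffeoGroup) (n : ℕ) (t : ℝ) : S.diffeoGroup := tailProd F n ⌊1 - t⌋₊

open Classical in
/-- The jump of `levels F n` at the level `t`. -/
def levelJump (F : ℕ → S.diffeoGroup) (t : ℝ) : S.diffeoGroup :=
  if t = -(⌊-t⌋₊ : ℝ) then F ⌊-t⌋₊ else 1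

theorem levelJump_neg (F : ℕ → S.diffeoGroup) (k : ℕ) : levelJump F (-(k : ℝ)) = F k := by
  simp [levelJump]

theorem levels_jump {F : ℕ → S.diffeoGroup} {n : ℕ} (hF : ∀ k, n ≤ k → F k = 1) (t₀ : ℝ) :
    ∀ᶠ t in 𝓝 t₀, levels F n t = if t ≤ t₀ then levels F n t₀
      else levelJump F t₀ * levels F n t₀ := by
  rcases lt_or_ge 0 t₀ with h0 | h0
  · have hj : levelJump F t₀ = 1 := by
      refine if_neg fun h => ?_
      have : (0 : ℝ) ≤ ⌊-t₀⌋₊ := Nat.cast_nonneg _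
      linarith
    filter_upwards [eventually_gt_nhds h0] with t ht
    -- The natural-number floor is truncated at `0`, so the value stays the full product at all
    -- positive heights.
    have e : ∀ s : ℝ, 0 < s → ⌊1 - s⌋₊ = 0 := fun s hs => Nat.floor_eq_zero.mpr (by linarith)
    rw [hj, one_mul, ite_self, levels, levels, e t ht, e t₀ h0]
  · obtain ⟨h1, h2⟩ := (Nat.floor_eq_iff (by linarith : (0 : ℝ) ≤ -t₀)).mp rfl
    have hj : t₀ = -(⌊-t₀⌋₊ : ℝ) ∧ levelJump F t₀ = F ⌊-t₀⌋₊ ∨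
        (⌊-t₀⌋₊ : ℝ) < -t₀ ∧ levelJump F t₀ = 1 := by
      by_cases h : t₀ = -(⌊-t₀⌋₊ : ℝ)
      · exact Or.inl ⟨h, if_pos h⟩
      · exact Or.inr ⟨lt_of_le_of_ne h1 fun h' => h (by linarith), if_neg h⟩
    generalize ⌊-t₀⌋₊ = k at *
    -- The offset in `⌊1 - t⌋₊` makes the height `-k` itself belong to the lower side, matching the
    -- convention `t ≤ 0` in `IsTwist`; the factor `F k` enters only strictly above.
    have e1 : ∀ s : ℝ, -(k + 1 : ℝ) < s → s ≤ -k → ⌊1 - s⌋₊ = k + 1 := fun s hs hs' =>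
      (Nat.floor_eq_iff (by have : (0 : ℝ) ≤ k := Nat.cast_nonneg _; linarith)).mpr
        ⟨by push_cast; linarith, by push_cast; linarith⟩
    have e2 : ∀ s : ℝ, -(k : ℝ) < s → s < -(k : ℝ) + 1 → ⌊1 - s⌋₊ = k := fun s hs hs' =>
      (Nat.floor_eq_iff (by have : (0 : ℝ) ≤ k := Nat.cast_nonneg _; linarith)).mpr
        ⟨by linarith, by linarith⟩
    have hl : -(k + 1 : ℝ) < t₀ := by linarith
    rcases hj with ⟨ht₀, hj⟩ | ⟨hlt, hj⟩
    · filter_upwards [eventually_gt_nhds hl,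
        eventually_lt_nhds (by linarith : t₀ < t₀ + 1)] with t ht ht'
      rw [hj, levels, levels, e1 t₀ hl ht₀.le]
      split_ifs with h
      · rw [e1 t ht (by linarith)]
      · rw [e2 t (by linarith) (by linarith), tailProd_eq_mul hF k]
    · filter_upwards [eventually_gt_nhds hl,
        eventually_lt_nhds (by linarith : t₀ < -(k : ℝ))] with t ht ht'
      rw [hj, one_mul, ite_self, levels, levels, e1 t₀ hl (by linarith), e1 t ht ht'.le]

theorem isStepFunction_levels {F : ℕ → S.diffeoGroup} {n : ℕ} (hF : ∀ k, n ≤ k → F k = 1) :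
    IsStepFunction (levels F n) (levelJump F) (tailProd F n 0) (n + 1) where
  jump := levels_jump hF
  pos := by positivity
  below t ht := tailProd_of_le F (Nat.le_floor (by linarith))
  above t ht := by
    have h : ⌊1 - t⌋₊ = 0 := Nat.floor_eq_zero.mpr (by
      have : (0 : ℝ) ≤ n := Nat.cast_nonneg _
      linarith)
    rw [levels, h]
  near_boundary := by
    -- The nontrivial values form a finite family, so a common neighbourhood of the boundary exists.
    have h : ∀ᶠ x in 𝓝ˢ ((𝓡∂ 2).boundary S), ∀ m ∈ Finset.range n, (tailProd F n m).1 x = x :=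
      (Filter.eventually_all_finset _).mpr fun m _ => (tailProd F n m).2.2.2.2
    filter_upwards [h] with x hx t
    rcases lt_or_ge ⌊1 - t⌋₊ n with h' | h'
    · exact hx _ (Finset.mem_range.mpr h')
    · rw [levels, tailProd_of_le F h']
      rfl

end Levels

variable {R : Type v} [TopologicalSpace R] [ChartedSpace (EuclideanSpace ℝ (Fin 2)) R]
  {oR : ManifoldOrientation (𝓡 2) R} {M : ParamManifold.{u} oR} {E : EmbeddedSurface M}
  {N : ParamManifold.{u} oR} {h : M ≃ N}

/-- Regluing along one surface by a product of diffeomorphisms amounts to a twist along parallel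
copies of the surface by the factors. -/
theorem IsRegluing.isTwist_shift {n : ℕ} {F : ℕ → E.S.diffeoGroup} (hF : ∀ k, n ≤ k → F k = 1)
    (hh : E.IsRegluing (tailProd F n 0) N h) (J : Finset (Fin n))
    (hFJ : ∀ k : Fin n, k ∉ J → F k = 1) (s : Fin n → E.S.MappingClassGroup)
    (hs : ∀ k ∈ J, QuotientGroup.mk (F (k : ℕ)) = s k) :
    IsTwist M (fun k : J => E.shift (-((k : Fin n) : ℕ) : ℝ)) (fun k => s k) N := by
  have hP := isStepFunction_levels hF
  refine ⟨fun k => F (k : Fin n), spread (levels F n) (tailProd F n 0) h, fun k => hs k k.2,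
    fun r => ?_, fun p hp => hP.off_support hh ?_, fun k x hx => ?_⟩
  · rw [← hh.param r]
    refine spread_of_notMem fun hr => ?_
    have h1 : M.param r ∈ (𝓡∂ 3).boundary M := M.param_range ▸ mem_range_self r
    exact (ModelWithCorners.disjoint_interior_boundary (I := 𝓡∂ 3) (M := M)).le_bot
      ⟨E.thick_interior hr, h1⟩
  · rintro x t rfl hx
    have hone : closure {x : E.S | (1 : E.S.diffeoGroup).1 x ≠ x} = ∅ := by
      rw [closure_empty_iff, Set.eq_empty_iff_forall_notMem]
      exact fun y hy => hy rfl
    -- Only heights `-k` with `k ∈ J` carry a surface of the twist. At every other height the jump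
    -- is `1`, with empty support.
    by_cases ht : t = -(⌊-t⌋₊ : ℝ)
    · generalize ⌊-t⌋₊ = k at ht
      subst ht
      rw [levelJump_neg] at hx
      by_cases hk : ∃ hkn : k < n, (⟨k, hkn⟩ : Fin n) ∈ J
      · obtain ⟨hkn, hkJ⟩ := hk
        refine hp ⟨⟨k, hkn⟩, hkJ⟩ x hx ?_
        rw [shift_thick, zero_add]
      · have hFk : F k = 1 := by
          by_cases hkn : k < n
          · exact hFJ ⟨k, hkn⟩ fun h' => hk ⟨hkn, h'⟩
          · exact hF k (not_lt.mp hkn)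
        rw [hFk, hone] at hx
        exact hx
    · rw [levelJump, if_neg ht, hone] at hx
      exact hx
  · have h1 := hP.across hh hx (-((k : Fin n) : ℕ) : ℝ)
    rw [levelJump_neg] at h1
    exact h1

/-- A twist along a surface is a twist along its parallel copy at height zero. -/
theorem _root_.IsTwist.shift_zero {n : ℕ} {a : E.S.MappingClassGroup}
    (hN : IsTwist M (fun _ : Unit => E) (fun _ => a) N)
    (s : Fin (n + 1) → E.S.MappingClassGroup) (hs : s 0 = a) :
    IsTwist M (fun k : ({0} : Finset (Fin (n + 1))) => E.shift (-((k : Fin (n + 1)) : ℕ) : ℝ))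
      (fun k => s k) N := by
  obtain ⟨f, h, hf, hparam, hoff, hacross⟩ := hN
  have hk : ∀ k : ({0} : Finset (Fin (n + 1))), (k : Fin (n + 1)) = 0 := fun k =>
    Finset.mem_singleton.mp k.2
  have hthick : ∀ (k : ({0} : Finset (Fin (n + 1)))) (q : E.S × ℝ),
      (E.shift (-((k : Fin (n + 1)) : ℕ) : ℝ)).thick q = E.thick q := by
    rintro k ⟨x, t⟩
    have h0 : (-((k : Fin (n + 1)) : ℕ) : ℝ) = 0 := by
      rw [hk k]
      simp
    exact (congrArg (fun c : ℝ => E.thick (x, t + c)) h0).trans (by rw [add_zero])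
  refine ⟨fun _ => f (), h, fun k => ?_, hparam, fun p hp => hoff p ?_, fun k x hx => ?_⟩
  · exact (hf ()).trans ((congrArg s (hk k)).trans hs).symm
  · exact fun _ x hx h' => hp ⟨0, Finset.mem_singleton_self 0⟩ x hx
      (h'.trans (hthick _ (x, 0)).symm)
  · have h1 := hacross () x hx
    refine h1.congr_of_eventuallyEq (Filter.Eventually.of_forall fun q => ?_)
    by_cases hq : q.2 ≤ 0
    · exact (if_pos hq).trans ((congrArg h (hthick k q)).trans (if_pos hq).symm)
    · exact (if_neg hq).trans ((congrArg h (hthick k _)).trans (if_neg hq).symm)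

theorem IsRegluing.isTwist {f : E.S.diffeoGroup} (hh : E.IsRegluing f N h) :
    IsTwist M (fun _ : Unit => E) (fun _ => QuotientGroup.mk f) N := by
  refine ⟨fun _ => f, h, fun _ => rfl, hh.param, fun p hp => hh.off_support p (hp ()),
    fun _ x hx => ?_⟩
  have h1 := (E.thick_open x hx 0).comp _ _ (hh.across x hx 0).1
  refine h1.congr_of_eventuallyEq (Filter.Eventually.of_forall fun q => ?_)
  simp only [Function.comp_apply, levelTwist_thick, step]
  split_ifs <;> rfl

/-- Lets `M` itself be compared with the trivial mapping class. -/
theorem isTwist_one : IsTwist M (fun _ : Unit => E) (fun _ => 1) M := by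
  refine ⟨fun _ => 1, Equiv.refl M, fun _ => rfl, fun _ => rfl, fun p _ =>
    ⟨(Diffeomorph.refl (𝓡∂ 3) M ∞).isLocalDiffeomorph p, orientationPreservingAt_id _ p⟩,
    fun _ x hx => (E.thick_open x hx 0).congr_of_eventuallyEq
      (Filter.Eventually.of_forall fun q => ?_)⟩
  exact ite_self _

end EmbeddedSurface

/-! ### The lower central series and the augmentation ideal -/

section GroupRing

variable {G : Type*} [Group G]

/-- The additive subgroup of the integral group ring spanned by the elements `1 - g`, `g ∈ T`. -/
def augmentation (T : Subgroup G) : Submodule ℤ (FreeAbelianGroup G) :=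
  Submodule.span ℤ ((fun g => 1 - FreeAbelianGroup.of g) '' (T : Set G))

theorem one_sub_of_mem_augmentation {T : Subgroup G} {g : G} (hg : g ∈ T) :
    1 - FreeAbelianGroup.of g ∈ augmentation T :=
  Submodule.subset_span (mem_image_of_mem _ hg)

/-- On generators, `(1 - a) g = (1 - a g) - (1 - g)`; both terms stay in the span because `a` and
`g` lie in `T`. -/
theorem augmentation_mul_of_mem {T : Subgroup G} {g : G} (hg : g ∈ T) {x : FreeAbelianGroup G}
    (hx : x ∈ augmentation T) : x * FreeAbelianGroup.of g ∈ augmentation T := by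
  induction hx using Submodule.span_induction with
  | mem x hx =>
    obtain ⟨a, ha, rfl⟩ := hx
    have e : (1 - FreeAbelianGroup.of a) * FreeAbelianGroup.of g
        = (1 - FreeAbelianGroup.of (a * g)) - (1 - FreeAbelianGroup.of g) := by
      rw [FreeAbelianGroup.of_mul]
      noncomm_ring
    rw [e]
    exact sub_mem (one_sub_of_mem_augmentation (T.mul_mem ha hg)) (one_sub_of_mem_augmentation hg)
  | zero => simp
  | add x y _ _ hx hy => rw [add_mul]; exact add_mem hx hy
  | smul c x _ hx => rw [smul_mul_assoc]; exact Submodule.smul_mem _ c hx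

/-- Multiplication by `g` is absorbed by the last factor. The exponent must be positive: the zeroth
power consists of the multiples of `1`. -/
theorem augmentation_pow_mul_of_mem {T : Subgroup G} {g : G} (hg : g ∈ T) (n : ℕ)
    {x : FreeAbelianGroup G} (hx : x ∈ augmentation T ^ (n + 1)) :
    x * FreeAbelianGroup.of g ∈ augmentation T ^ (n + 1) := by
  rw [pow_succ] at hx ⊢
  induction hx using Submodule.mul_induction_on' with
  | mem_mul_mem a ha b hb =>
    rw [mul_assoc]
    exact Submodule.mul_mem_mul ha (augmentation_mul_of_mem hg hb)
  | add x _ y _ hx hy => rw [add_mul]; exact add_mem hx hy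

/-- Induction along the lower central series, using `1 - p q p⁻¹ q⁻¹ = ((1 - q)(1 - p) - (1 - p)(1 -
q)) p⁻¹ q⁻¹`: each commutator gains one factor. Membership in `T` is carried along because the
powers are stable only under multiplication by elements of `T`. -/
theorem one_sub_of_mem_augmentation_pow {T : Subgroup G} (n : ℕ) {g : G}
    (hg : g ∈ T.lowerCentralSeries n) :
    g ∈ T ∧ 1 - FreeAbelianGroup.of g ∈ augmentation T ^ (n + 1) := by
  induction n generalizing g with
  | zero => exact ⟨hg, by simpa using one_sub_of_mem_augmentation hg⟩
  | succ n ih =>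
    rw [Subgroup.mem_lowerCentralSeries_succ_iff] at hg
    induction hg using Subgroup.closure_induction with
    | mem x hx =>
      obtain ⟨p, hp, q, hq, rfl⟩ := hx
      obtain ⟨hpT, hpI⟩ := ih hp
      have hT : p⁻¹ * q⁻¹ ∈ T := T.mul_mem (T.inv_mem hpT) (T.inv_mem hq)
      rw [commutatorElement_def]
      refine ⟨?_, ?_⟩
      · rw [mul_assoc]
        exact T.mul_mem (T.mul_mem hpT hq) hT
      · have e : 1 - FreeAbelianGroup.of (p * q * p⁻¹ * q⁻¹)
            = ((1 - FreeAbelianGroup.of q) * (1 - FreeAbelianGroup.of p)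
              - (1 - FreeAbelianGroup.of p) * (1 - FreeAbelianGroup.of q))
              * FreeAbelianGroup.of (p⁻¹ * q⁻¹) := by
          have e1 : (1 - FreeAbelianGroup.of q) * (1 - FreeAbelianGroup.of p)
              - (1 - FreeAbelianGroup.of p) * (1 - FreeAbelianGroup.of q)
              = FreeAbelianGroup.of (q * p) - FreeAbelianGroup.of (p * q) := by
            rw [FreeAbelianGroup.of_mul, FreeAbelianGroup.of_mul]
            noncomm_ring
          rw [e1, sub_mul, ← FreeAbelianGroup.of_mul, ← FreeAbelianGroup.of_mul]
          have e2 : q * p * (p⁻¹ * q⁻¹) = 1 := by group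
          have e3 : p * q * (p⁻¹ * q⁻¹) = p * q * p⁻¹ * q⁻¹ := by group
          rw [e2, e3, FreeAbelianGroup.of_one]
        rw [e]
        refine augmentation_pow_mul_of_mem hT _ (sub_mem ?_ ?_)
        · rw [pow_succ']
          exact Submodule.mul_mem_mul (one_sub_of_mem_augmentation hq) hpI
        · rw [pow_succ]
          exact Submodule.mul_mem_mul hpI (one_sub_of_mem_augmentation hq)
    | one => exact ⟨T.one_mem, by simp [FreeAbelianGroup.of_one]⟩
    | mul x y _ _ hx hy =>
      refine ⟨T.mul_mem hx.1 hy.1, ?_⟩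
      have e : 1 - FreeAbelianGroup.of (x * y)
          = (1 - FreeAbelianGroup.of x) * FreeAbelianGroup.of y
            + (1 - FreeAbelianGroup.of y) := by
        rw [FreeAbelianGroup.of_mul]
        noncomm_ring
      rw [e]
      exact add_mem (augmentation_pow_mul_of_mem hy.1 _ hx.2) hy.2
    | inv x _ hx =>
      have hT := T.inv_mem hx.1
      refine ⟨hT, ?_⟩
      have e : 1 - FreeAbelianGroup.of x⁻¹
          = -((1 - FreeAbelianGroup.of x) * FreeAbelianGroup.of x⁻¹) := by
        rw [sub_mul, ← FreeAbelianGroup.of_mul, mul_inv_cancel, FreeAbelianGroup.of_one]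
        noncomm_ring
      rw [e]
      exact neg_mem (augmentation_pow_mul_of_mem hT _ hx.2)

/-- Multilinear expansion of the ordered product, valid without commutativity; `J` records the
positions where `-a i` is chosen instead of `1`. -/
theorem prod_ofFn_one_sub {R : Type*} [Ring R] {n : ℕ} (a : Fin n → R) :
    (List.ofFn fun i => 1 - a i).prod
      = ∑ J : Finset (Fin n), (-1 : ℤ) ^ J.card • (List.ofFn (J.piecewise a 1)).prod := by
  have h := (MultilinearMap.mkPiAlgebraFin ℤ n R).map_add_univ (fun i => (-1 : ℤ) • a i) 1
  simp only [MultilinearMap.mkPiAlgebraFin_apply] at h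
  have e : (fun i => 1 - a i) = (fun i => (-1 : ℤ) • a i) + 1 := by
    funext i
    simp only [Pi.add_apply, Pi.one_apply, neg_smul, one_smul]
    abel
  rw [e, h]
  refine Finset.sum_congr rfl fun J _ => ?_
  have h2 := (MultilinearMap.mkPiAlgebraFin ℤ n R).map_piecewise_smul (fun _ => (-1 : ℤ))
    (J.piecewise a 1) J
  simp only [MultilinearMap.mkPiAlgebraFin_apply, Finset.prod_const] at h2
  rw [← h2]
  congr 2
  funext i
  by_cases hi : i ∈ J <;> simp [hi]

/-- The hypothesis says that the linear extension of `φ` kills the products of `d + 1` generators `1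
- s i`. These span the `(d+1)`-st power of the augmentation, which contains `1 - a`. -/
theorem map_eq_map_one_of_mem_lowerCentralSeries {A : Type*} [AddCommGroup A] (T : Subgroup G)
    (φ : G → A) (d : ℕ)
    (hφ : ∀ s : Fin (d + 1) → G, (∀ i, s i ∈ T) →
      ∑ J : Finset (Fin (d + 1)), (-1 : ℤ) ^ J.card • φ (List.ofFn (J.piecewise s 1)).prod = 0)
    {a : G} (ha : a ∈ T.lowerCentralSeries d) : φ a = φ 1 := by
  have hle : augmentation T ^ (d + 1)
      ≤ LinearMap.ker (FreeAbelianGroup.lift φ).toIntLinearMap := by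
    rw [augmentation, Submodule.span_pow, Submodule.span_le]
    intro x hx
    obtain ⟨f, rfl⟩ := Set.mem_pow.mp hx
    choose s hsT hs using fun i => (f i).2
    have e : (fun i => ((f i : FreeAbelianGroup G))) = fun i => 1 - FreeAbelianGroup.of (s i) :=
      funext fun i => (hs i).symm
    rw [SetLike.mem_coe, LinearMap.mem_ker, AddMonoidHom.coe_toIntLinearMap, e, prod_ofFn_one_sub,
      map_sum, ← hφ s hsT]
    refine Finset.sum_congr rfl fun J _ => ?_
    rw [map_zsmul]
    congr 1
    have e2 : J.piecewise (fun i => FreeAbelianGroup.of (s i)) 1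
        = fun i => FreeAbelianGroup.ofMulHom (J.piecewise s 1 i) := by
      funext i
      by_cases hi : i ∈ J <;> simp [hi, FreeAbelianGroup.of_one]
    have e3 : (List.ofFn fun i => FreeAbelianGroup.ofMulHom (J.piecewise s 1 i)).prod
        = FreeAbelianGroup.of (List.ofFn (J.piecewise s 1)).prod := by
      have h := map_list_prod (FreeAbelianGroup.ofMulHom (α := G)) (List.ofFn (J.piecewise s 1))
      rw [List.map_ofFn] at h
      exact h.symm
    rw [e2, e3, FreeAbelianGroup.lift_apply_of]
  have h := hle (one_sub_of_mem_augmentation_pow d ha).2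
  rw [LinearMap.mem_ker, AddMonoidHom.coe_toIntLinearMap, map_sub, ← FreeAbelianGroup.of_one,
    FreeAbelianGroup.lift_apply_of, FreeAbelianGroup.lift_apply_of, sub_eq_zero] at h
  exact h.symm

theorem tailProd_zero_eq_prod_ofFn {n : ℕ} (F : ℕ → G) (f : Fin n → G)
    (h : ∀ i : Fin n, F i = f i) : tailProd F n 0 = (List.ofFn f).prod := by
  have e : List.range' 0 (n - 0) = List.ofFn fun i : Fin n => (i : ℕ) := by
    rw [Nat.sub_zero, ← List.range_eq_range']
    exact List.ext_getElem (by simp) (by simp)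
  rw [tailProd, e, List.map_ofFn]
  congr 2
  exact funext h

end GroupRing

/-! ### Finite-type invariants and twists along one surface -/

section FiniteType

variable {R : Type v} [TopologicalSpace R] [ChartedSpace (EuclideanSpace ℝ (Fin 2)) R]
  {oR : ManifoldOrientation (𝓡 2) R} {M : ParamManifold.{u} oR}

/-- Keeps Torelli twists inside `V₀`; the first term of the lower central series is the Torelli
group by definition. -/
theorem mk_eq_of_isTwist {E : EmbeddedSurface M} {a : E.S.MappingClassGroup} (ha : a ∈ E.S.torelli)
    {N : ParamManifold.{u} oR} (hN : IsTwist M (fun _ : Unit => E) (fun _ => a) N) :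
    (Quot.mk (YEquiv 1) ⟦N⟧ : Quot (YEquiv.{u} (oR := oR) 1)) = Quot.mk _ ⟦M⟧ :=
  (Quot.sound ⟨M, N, rfl, rfl, E, a, ha, hN⟩).symm

/-- A manifold obtained by regluing `M` along `E` by the diffeomorphism `f`. -/
def EmbeddedSurface.twist (E : EmbeddedSurface M) (f : E.S.diffeoGroup) : ParamManifold.{u} oR :=
  (E.exists_isRegluing f).choose

theorem EmbeddedSurface.twist_spec (E : EmbeddedSurface M) (f : E.S.diffeoGroup) :
    ∃ h : M ≃ E.twist f, E.IsRegluing f (E.twist f) h := (E.exists_isRegluing f).choose_spec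

theorem EmbeddedSurface.isTwist_twist (E : EmbeddedSurface M) (f : E.S.diffeoGroup) :
    IsTwist M (fun _ : Unit => E) (fun _ => QuotientGroup.mk f) (E.twist f) :=
  (E.twist_spec f).choose_spec.isTwist

variable {V₀ : Quot (YEquiv.{u} (oR := oR) 1)}

/-- The class of `E.twist f`, as an element of the `Y₁`-equivalence class of `M`. -/
def EmbeddedSurface.twistClass (E : EmbeddedSurface M) (hM : Quot.mk _ ⟦M⟧ = V₀)
    (f : E.S.diffeoGroup) (hf : (QuotientGroup.mk f : E.S.MappingClassGroup) ∈ E.S.torelli) :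
    YOneClass V₀ :=
  ⟨⟦E.twist f⟧, (mk_eq_of_isTwist hf (E.isTwist_twist f)).trans hM⟩

/-- The product of the diffeomorphisms `f i` for `i ∈ J`, in increasing order. -/
def partialProd {G : Type*} [Group G] {n : ℕ} (f : Fin n → G) (J : Finset (Fin n)) : G :=
  (List.ofFn (J.piecewise f 1)).prod

theorem mk_partialProd {S : BoundedSurface.{u}} {n : ℕ} (f : Fin n → S.diffeoGroup)
    (J : Finset (Fin n)) :
    (QuotientGroup.mk (partialProd f J) : S.MappingClassGroup)
      = partialProd (fun i => (QuotientGroup.mk (f i) : S.MappingClassGroup)) J := by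
  have h := map_list_prod (QuotientGroup.mk' S.isotopicToOne) (List.ofFn (J.piecewise f 1))
  rw [List.map_ofFn] at h
  refine h.trans ?_
  unfold partialProd
  congr 2
  funext i
  by_cases hi : i ∈ J <;> simp [hi]

theorem partialProd_mem {G : Type*} [Group G] {n : ℕ} {T : Subgroup G} {s : Fin n → G}
    (hs : ∀ i, s i ∈ T) (J : Finset (Fin n)) : partialProd s J ∈ T := by
  refine T.list_prod_mem fun x hx => ?_
  obtain ⟨i, rfl⟩ := List.mem_ofFn.mp hx
  by_cases hi : i ∈ J
  · simpa [hi] using hs i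
  · simp [hi]

/-- A single regluing by the ordered product of the chosen factors realizes the simultaneous twist
over `J`: positions outside `J` carry the factor `1`, hence a trivial jump at their height. -/
theorem EmbeddedSurface.isTwist_shift_partialProd (E : EmbeddedSurface M) {n : ℕ}
    (f : Fin n → E.S.diffeoGroup) (J : Finset (Fin n)) :
    IsTwist M (fun k : J => E.shift (-((k : Fin n) : ℕ) : ℝ)) (fun k => QuotientGroup.mk (f k))
      (E.twist (partialProd f J)) := by
  let F : ℕ → E.S.diffeoGroup := fun k => if h : k < n then J.piecewise f 1 ⟨k, h⟩ else 1
  have hFi : ∀ i : Fin n, F i = J.piecewise f 1 i := fun i => dif_pos i.2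
  have e : tailProd F n 0 = partialProd f J := tailProd_zero_eq_prod_ofFn F _ hFi
  obtain ⟨h, hh⟩ := E.twist_spec (partialProd f J)
  refine EmbeddedSurface.IsRegluing.isTwist_shift (F := F) (h := h)
    (fun k hk => dif_neg (not_lt.mpr hk)) (by rwa [e]) J (fun k hk => ?_)
    (fun k => QuotientGroup.mk (f k)) fun k hk => ?_
  · rw [hFi]
    simp [hk]
  · rw [hFi]
    simp [hk]

variable {A : Type*} [AddCommGroup A] {d : ℕ} {F : YOneClass V₀ → A}

/-- The alternating sum over twists along parallel copies of one surface vanishes. -/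
theorem IsFiniteType.sum_shift (hF : IsFiniteType d F) (E : EmbeddedSurface M)
    (hM : Quot.mk _ ⟦M⟧ = V₀) (s : Fin (d + 1) → E.S.MappingClassGroup)
    (hs : ∀ i, s i ∈ E.S.torelli) (MJ : Finset (Fin (d + 1)) → YOneClass V₀)
    (hMJ : ∀ J, ∃ N : ParamManifold.{u} oR, ⟦N⟧ = (MJ J).1 ∧
      IsTwist M (fun k : J => E.shift (-((k : Fin (d + 1)) : ℕ) : ℝ)) (fun k => s k) N) :
    ∑ J : Finset (Fin (d + 1)), (-1 : ℤ) ^ J.card • F (MJ J) = 0 := by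
  refine hF M hM (fun k => E.shift (-(k : ℕ) : ℝ)) (fun i j hij => ?_) s hs MJ hMJ
  refine E.disjoint_shift_image fun h => hij ?_
  have h1 : ((i : ℕ) : ℝ) = (j : ℕ) := neg_injective h
  exact Fin.ext (Nat.cast_injective h1)

/-- A finite-type invariant takes the same value on any two manifolds obtained by twists along
the same surface with the same mapping class. -/
theorem IsFiniteType.eq_of_isTwist (hF : IsFiniteType d F) (E : EmbeddedSurface M)
    (hM : Quot.mk _ ⟦M⟧ = V₀) {a : E.S.MappingClassGroup} (ha : a ∈ E.S.torelli)
    {N N' : ParamManifold.{u} oR} (hN : IsTwist M (fun _ : Unit => E) (fun _ => a) N)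
    (hN' : IsTwist M (fun _ : Unit => E) (fun _ => a) N') (x x' : YOneClass V₀)
    (hx : x.1 = ⟦N⟧) (hx' : x'.1 = ⟦N'⟧) : F x = F x' := by
  classical
  obtain ⟨f₀, rfl⟩ := QuotientGroup.mk_surjective a
  -- One possibly nontrivial twist, at height zero, and `d` trivial ones: just enough copies for the
  -- finite-type condition.
  let f : Fin (d + 1) → E.S.diffeoGroup := fun i => if i = 0 then f₀ else 1
  have hf0 : f 0 = f₀ := if_pos rfl
  have hfT : ∀ i, (QuotientGroup.mk (f i) : E.S.MappingClassGroup) ∈ E.S.torelli := by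
    intro i
    by_cases hi : i = 0
    · rwa [hi, hf0]
    · have h1 : f i = 1 := if_neg hi
      rw [h1]
      exact E.S.torelli.one_mem
  let MJ : Finset (Fin (d + 1)) → YOneClass V₀ := fun J =>
    E.twistClass hM (partialProd f J) (by rw [mk_partialProd]; exact partialProd_mem hfT J)
  -- Substituting `x` for the term of `{0}` keeps the sum admissible, so `F x` is expressed by the
  -- remaining terms, which do not involve `N` or `x`.
  have key : ∀ (N : ParamManifold.{u} oR) (x : YOneClass V₀), x.1 = ⟦N⟧ →
      IsTwist M (fun _ : Unit => E) (fun _ => QuotientGroup.mk f₀) N →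
      F x = ∑ J ∈ {({0} : Finset (Fin (d + 1)))}ᶜ, (-1 : ℤ) ^ J.card • F (MJ J) := by
    intro N x hx hN
    have h1 := hF.sum_shift E hM (fun i => QuotientGroup.mk (f i)) hfT
      (Function.update MJ {0} x) fun J => by
        by_cases hJ : J = {0}
        · subst hJ
          exact ⟨N, by rw [Function.update_self, hx], hN.shift_zero
            (fun i => QuotientGroup.mk (f i)) (congrArg _ hf0)⟩
        · exact ⟨_, by rw [Function.update_of_ne hJ]; rfl, E.isTwist_shift_partialProd f J⟩
    rw [Fintype.sum_eq_add_sum_compl {0}, Function.update_self, Finset.card_singleton, pow_one,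
      neg_one_smul, neg_add_eq_zero] at h1
    rw [h1]
    refine Finset.sum_congr rfl fun J hJ => ?_
    rw [Function.update_of_ne (by simpa using hJ)]
  rw [key N x hx hN, key N' x' hx' hN']

end FiniteType

end

/-! ### The proposition -/

theorem mainTheorem2 {R : Type v} [TopologicalSpace R]
    [ChartedSpace (EuclideanSpace ℝ (Fin 2)) R] [IsManifold (𝓡 2) ∞ R]
    [T2Space R] [CompactSpace R] (oR : ManifoldOrientation (𝓡 2) R)
    (V₀ : Quot (YEquiv.{u} (oR := oR) 1)) {A : Type*} [AddCommGroup A] (d : ℕ)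
    (F : YOneClass V₀ → A) (hF : IsFiniteType d F)
    (M M' : YOneClass V₀) (h : YEquiv (d + 1) M.1 M'.1) :
    F M = F M' := by
  classical
  obtain ⟨M₀, N₀, hM₀, hN₀, E, a, ha, htw⟩ := h
  have hV : Quot.mk _ ⟦M₀⟧ = V₀ := by rw [hM₀]; exact M.2
  have haT : a ∈ E.S.torelli := (one_sub_of_mem_augmentation_pow d ha).1
  let φ : E.S.MappingClassGroup → A := fun b =>
    if hb : b ∈ E.S.torelli then
      F (E.twistClass hV b.out (by rwa [QuotientGroup.out_eq']))
    else 0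
  have hφ : ∀ b ∈ E.S.torelli, ∀ (N : ParamManifold.{u} oR) (x : YOneClass V₀), x.1 = ⟦N⟧ →
      IsTwist M₀ (fun _ : Unit => E) (fun _ => b) N → φ b = F x := by
    intro b hb N x hx hN
    have h1 : IsTwist M₀ (fun _ : Unit => E) (fun _ => b) (E.twist b.out) := by
      have := E.isTwist_twist b.out
      rwa [QuotientGroup.out_eq'] at this
    exact (dif_pos hb).trans (hF.eq_of_isTwist E hV hb h1 hN _ x rfl hx)
  -- The index is shifted by one: the term of index `d + 1` counted from `1` is the term `d` of
  -- `Subgroup.lowerCentralSeries`, counted from `0`.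
  have h1 : φ a = φ 1 := by
    refine map_eq_map_one_of_mem_lowerCentralSeries E.S.torelli φ d (fun s hs => ?_) ha
    choose f hf using fun i => QuotientGroup.mk_surjective (s i)
    obtain rfl : (fun i => QuotientGroup.mk (f i)) = s := funext hf
    have hmem : ∀ J, (QuotientGroup.mk (partialProd f J) : E.S.MappingClassGroup) ∈ E.S.torelli :=
      fun J => by rw [mk_partialProd]; exact partialProd_mem hs J
    rw [← hF.sum_shift E hV _ hs (fun J => E.twistClass hV (partialProd f J) (hmem J))
      fun J => ⟨_, rfl, E.isTwist_shift_partialProd f J⟩]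
    refine Finset.sum_congr rfl fun J _ => congrArg _ ?_
    have h2 := hφ _ (hmem J) _ (E.twistClass hV (partialProd f J) (hmem J)) rfl
      (E.isTwist_twist _)
    rw [mk_partialProd] at h2
    exact h2
  rw [← hφ 1 E.S.torelli.one_mem M₀ M hM₀.symm E.isTwist_one, ← h1]
  exact hφ a haT N₀ M' hN₀.symm htw
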